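/- Let $K$ be an ordered field, $K[\mathbf X]$ a polynomial ring over $K$ in finitely many variables, and $\ll$ a monomial order (a total order on monomials that is compatible with multiplication and has $1$ as least element). Write $a\gg b$ for "$a$ is greater than or equal to $b$", and put $\mathrm{LM}(0)=1$. Let $p_1,\dots,p_k,q_1,\dots,q_r,t\in K[\mathbf X]$ and let $$C=\langle p_1,\dots,p_k\rangle+[q_1,\dots,q_r,1]=\Big\{a+\sum_{i=1}^r\lambda_iq_i+\lambda_{r+1} : a\in\langle p_1,\dots,p_k\rangle,\ \lambda_1,\dots,\lambda_{r+1}\in K_{\ge 0}\Big\}.$$ **Reduction by $C$.** A result $t^*=\mathbf{cred}_C(t)$ is any polynomial produced by the following procedure, in which every choice that is not specified is arbitrary. 1. Choose a (finite) Gröbner basis $B$ of $\langle p_1,\dots,p_k\rangle$, and compute by multivariate division by $B$ remainders $t_i$ of $q_i$ and $t'$ of $t$. Treat each monomial other than $1$ that occurs in $t',t_1,\dots,t_r$ as a dimension; list the dimensions as $d_1,\dots,d_n$ from greatest to smallest. Polynomials in these monomials are then affine terms. 2. (Polyhedral reduction.) Let $T$ be a new dimension, $P=\{t_1\ge0,\dots,t_r\ge0,\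 T=t'\}$ and $U=\emptyset$. While there is a model $v$ of $P$ with $T>u$ at $v$ for all $u\in U$, pick such a $v$ and add to $U$ a set of bounds conjectured from $v$. When there is no such $v$ left, the results are those $u\in U$ for which $T\le u$ holds on all of $P$. *Conjectured bounds.* An upper bound on $T$ in a finite set of constraints is $-b/a$ for a constraint $aT+b\ge0$ with $a<0$, or $aT+b=0$ with $a\ne0$, where $b$ is $T$-free. Starting with $P_0=P$, let $P_i$ be a local projection of $d_i$ from $P_{i-1}$ with respect to $v$, as long as $i\le n$ and $P_i$ contains an upper bound on $T$. The conjectured bounds are all upper bounds on $T$ in the last $P_i$ that contains one. *Local projection* of $x$ from $P$ with respect to $v$. Rewrite the constraints of $P$ that involve $x$ as $x=e$, $x\ge lb$ or $x\le ub$ with $x$-free $e$, $lb$, $ub$. If there is a constraint $x=e$, choose one and substitute $e$ for $x$ in all of $P$. Otherwise, if there is no constraint $x\ge lb$, keep the constraints that do not involve $x$. Otherwise choose $lb^*$ among the lower bounds $lb$ with the greatest value at $v$, and take all $lb\le lb^*$, all $lb^*\le ub$, and the constraints that do not involve $x$. **Theorem.** * *Runs.* A Gröbner basis of $\langle p_1,\dots,p_k\rangle$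 exists, and every run of the procedure is finite. If $-1\notin C$ or $1\in\langle p_1,\dots,p_k\rangle$ (that is, if the polyhedron $\{t_1\ge0,\dots,t_r\ge0\}$ is non-empty), some run produces a result $t^*$. * *Correctness.* Every result $t^*$ produced by any run of the procedure satisfies 1. $t^*-t\in C$; 2. $t^*$ is optimal: $\mathrm{LM}(b)\gg\mathrm{LM}(t^*)$ for every polynomial $b$ with $b-t\in C$. -/

import Mathlib

open scoped MonomialOrder

namespace PolyCone

/-! ### Nondeterministic procedures -/

/-- No infinite execution of the transition relation `R` starts at `a`. -/
def Terminates {S : Type*} (R : S → S → Prop) (a : S) : Prop :=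
  ¬ ∃ s : ℕ → S, s 0 = a ∧ ∀ n, R (s n) (s (n + 1))

/-! ### Affine terms, constraints and polyhedra over a type `D` of dimensions -/

/-- An affine term `∑ a_d • d + b` over the dimensions `D`: the pair `(a, b)`. -/
abbrev Aff (K D : Type*) [Field K] := (D →₀ K) × K

/-- The value of an affine term at a point. -/
noncomputable def Aff.eval {K D : Type*} [Field K] (e : Aff K D) (v : D → K) : K :=
  e.1.sum (fun d a => a * v d) + e.2

/-- The coefficient of the dimension `x` in an affine term. -/
def Aff.coeff {K D : Type*} [Field K] (x : D) (e : Aff K D) : K := e.1 x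

/-- The affine term consisting of the single dimension `x`. -/
noncomputable def Aff.dim {K D : Type*} [Field K] (x : D) : Aff K D := (Finsupp.single x 1, 0)

/-- `e` with its `x`-part `a x` removed. -/
noncomputable def Aff.drop {K D : Type*} [Field K] (x : D) (e : Aff K D) : Aff K D :=
  e - Aff.coeff x e • Aff.dim x

/-- Writing `e = a x + f` with `f` free of `x` and `a ≠ 0`, this is `-f / a`. -/
noncomputable def Aff.solve {K D : Type*} [Field K] (x : D) (e : Aff K D) : Aff K D :=
  -((Aff.coeff x e)⁻¹ • Aff.drop x e)

/-- The substitution `c[x ↦ e]`. -/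
noncomputable def Aff.subst {K D : Type*} [Field K] (x : D) (e c : Aff K D) : Aff K D :=
  Aff.drop x c + Aff.coeff x c • e

/-- A (non-strict) linear constraint: `e = 0` or `e ≥ 0`. -/
inductive Constraint (K D : Type*) [Field K]
  | eq (e : Aff K D) : Constraint K D
  | ge (e : Aff K D) : Constraint K D

/-- The affine term of a constraint. -/
def Constraint.term {K D : Type*} [Field K] : Constraint K D → Aff K D
  | .eq e => e
  | .ge e => e

/-- Substitution in a constraint. -/
noncomputable def Constraint.subst {K D : Type*} [Field K] (x : D) (e : Aff K D) :
    Constraint K D → Constraint K D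
  | .eq c => .eq (Aff.subst x e c)
  | .ge c => .ge (Aff.subst x e c)

/-- The point `v` satisfies a constraint. -/
def Constraint.Holds {K D : Type*} [Field K] [LinearOrder K] (v : D → K) : Constraint K D → Prop
  | .eq e => e.eval v = 0
  | .ge e => 0 ≤ e.eval v

/-- `v` is a model of the polyhedron given by the set of constraints `P`. -/
def IsModel {K D : Type*} [Field K] [LinearOrder K] (v : D → K) (P : Set (Constraint K D)) : Prop :=
  ∀ c ∈ P, c.Holds v

/-! ### Local projection -/

/-- The terms `e` such that `x = e` is one of the equality constraints of `P` involving `x`. -/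
def eqTerms {K D : Type*} [Field K] (x : D) (P : Set (Constraint K D)) : Set (Aff K D) :=
  {e | ∃ c, Constraint.eq c ∈ P ∧ Aff.coeff x c ≠ 0 ∧ e = Aff.solve x c}

/-- The terms `lb` such that `x ≥ lb` is one of the inequality constraints of `P`. -/
def lowerTerms {K D : Type*} [Field K] [LinearOrder K] (x : D) (P : Set (Constraint K D)) :
    Set (Aff K D) :=
  {e | ∃ c, Constraint.ge c ∈ P ∧ 0 < Aff.coeff x c ∧ e = Aff.solve x c}

/-- The terms `ub` such that `x ≤ ub` is one of the inequality constraints of `P`. -/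
def upperTerms {K D : Type*} [Field K] [LinearOrder K] (x : D) (P : Set (Constraint K D)) :
    Set (Aff K D) :=
  {e | ∃ c, Constraint.ge c ∈ P ∧ Aff.coeff x c < 0 ∧ e = Aff.solve x c}

/-- The constraints of `P` that do not involve `x`. -/
def freeConstraints {K D : Type*} [Field K] (x : D) (P : Set (Constraint K D)) :
    Set (Constraint K D) :=
  {c ∈ P | Aff.coeff x c.term = 0}

/-- `LocalProj v P x P'`: `P'` is a local projection of the dimension `x` from `P` with respect to
the model `v`. The choices of an equality `x = e` and of a binding lower bound `lb` are free. -/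
inductive LocalProj {K D : Type*} [Field K] [LinearOrder K] (v : D → K)
    (P : Set (Constraint K D)) (x : D) : Set (Constraint K D) → Prop
  | equality (e : Aff K D) (he : e ∈ eqTerms x P) :
      LocalProj v P x (Constraint.subst x e '' P)
  | noLower (hE : eqTerms x P = ∅) (hL : lowerTerms x P = ∅) :
      LocalProj v P x (freeConstraints x P)
  | lower (hE : eqTerms x P = ∅) (lb : Aff K D) (hlb : lb ∈ lowerTerms x P)
      (hmax : ∀ l ∈ lowerTerms x P, l.eval v ≤ lb.eval v) :
      LocalProj v P x
        ({c | ∃ l ∈ lowerTerms x P, c = Constraint.ge (lb - l)} ∪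
          {c | ∃ u ∈ upperTerms x P, c = Constraint.ge (u - lb)} ∪ freeConstraints x P)

/-! ### Conjecturing bounds and polyhedral reduction -/

/-- The upper bounds `u` on the dimension `T` that can be read off the constraints of `P`
(an equality counts as two inequalities). -/
def boundsOn {K D : Type*} [Field K] [LinearOrder K] (T : D) (P : Set (Constraint K D)) :
    Set (Aff K D) :=
  upperTerms T P ∪ eqTerms T P

/-- `Conjecture v T P ds B`: locally projecting out the dimensions `ds` from `P` one after the
other, for as long as `T` keeps an upper bound, can end with the set `B` of upper bounds on `T`. -/
inductive Conjecture {K D : Type*} [Field K] [LinearOrder K] (v : D → K) (T : D) :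
    Set (Constraint K D) → List D → Set (Aff K D) → Prop
  | exhausted (P : Set (Constraint K D)) : Conjecture v T P [] (boundsOn T P)
  | unbounded (P P' : Set (Constraint K D)) (d : D) (ds : List D) (h : LocalProj v P d P')
      (hT : boundsOn T P' = ∅) : Conjecture v T P (d :: ds) (boundsOn T P)
  | project (P P' : Set (Constraint K D)) (d : D) (ds : List D) (B : Set (Aff K D))
      (h : LocalProj v P d P') (hT : (boundsOn T P').Nonempty) (hB : Conjecture v T P' ds B) :
      Conjecture v T P (d :: ds) B

/-- `v` is a model of `P` that violates every bound `T ≤ u`, `u ∈ U`. -/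
def IsSample {K D : Type*} [Field K] [LinearOrder K] (T : D) (P : Set (Constraint K D))
    (U : Set (Aff K D)) (v : D → K) : Prop :=
  IsModel v P ∧ ∀ u ∈ U, ¬ v T ≤ u.eval v

/-- One iteration of the main loop of polyhedral reduction. -/
def ReduceStep {K D : Type*} [Field K] [LinearOrder K] (T : D) (P : Set (Constraint K D))
    (ds : List D) (U U' : Set (Aff K D)) : Prop :=
  ∃ v, IsSample T P U v ∧ ∃ B, Conjecture v T P ds B ∧ U' = U ∪ B

/-- The polyhedron `P` with the constraint `T = t` added. -/
def withTarget {K D : Type*} [Field K] (T : D) (P : Set (Constraint K D)) (t : Aff K D) :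
    Set (Constraint K D) :=
  P ∪ {Constraint.eq (Aff.dim T - t)}

/-- `PolyReduce T P t ds u`: some complete run of polyhedral reduction of the term `t` by `P`, with
the dimensions `ds` listed from greatest to smallest and with the new dimension `T`, returns `u`
among its bounds. -/
def PolyReduce {K D : Type*} [Field K] [LinearOrder K] (T : D) (P : Set (Constraint K D))
    (t : Aff K D) (ds : List D) (u : Aff K D) : Prop :=
  ∃ U, Relation.ReflTransGen (ReduceStep T (withTarget T P t) ds) ∅ U ∧
    (¬ ∃ v, IsSample T (withTarget T P t) U v) ∧
    u ∈ U ∧ ∀ v, IsModel v (withTarget T P t) → v T ≤ u.eval v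

/-! ### Cones of polynomials -/

/-- The polyhedral cone `[v_1, …, v_n]`. -/
def polyhedralCone (K : Type*) {V : Type*} [Field K] [LinearOrder K] [AddCommGroup V] [Module K V]
    {n : ℕ} (v : Fin n → V) : Set V :=
  {x | ∃ c : Fin n → K, (∀ i, 0 ≤ c i) ∧ x = ∑ i, c i • v i}

/-- The cone of polynomials `⟨p_1, …, p_k⟩ + [q_1, …, q_r, 1]`. -/
def coneOf {K σ : Type*} [Field K] [LinearOrder K] {k r : ℕ} (p : Fin k → MvPolynomial σ K)
    (q : Fin r → MvPolynomial σ K) : Set (MvPolynomial σ K) :=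
  {f | ∃ a ∈ Ideal.span (Set.range p),
    ∃ b ∈ polyhedralCone K (Fin.snoc q 1 : Fin (r + 1) → MvPolynomial σ K), f = a + b}

/-! ### Gröbner bases and multivariate division -/

/-- `B` is a Gröbner basis of `I`: a finite subset of `I` whose leading terms generate the ideal
generated by all leading terms of `I`. -/
def IsGroebnerBasis {K σ : Type*} [Field K] (m : MonomialOrder σ)
    (B : Finset (MvPolynomial σ K)) (I : Ideal (MvPolynomial σ K)) : Prop :=
  (B : Set (MvPolynomial σ K)) ⊆ I ∧
    Ideal.span (m.leadingTerm '' (B : Set (MvPolynomial σ K))) =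
      Ideal.span (m.leadingTerm '' (I : Set (MvPolynomial σ K)))

/-- One step of the multivariate division algorithm by `B`. A state is a pair (what remains to be
divided, remainder so far). The leading term of the first component is cancelled by a multiple of
some element of `B` if possible, and is moved to the remainder otherwise. -/
inductive DivStep {K σ : Type*} [Field K] (m : MonomialOrder σ) (B : Finset (MvPolynomial σ K)) :
    MvPolynomial σ K × MvPolynomial σ K → MvPolynomial σ K × MvPolynomial σ K → Prop
  | divide (f s g : MvPolynomial σ K) (hf : f ≠ 0) (hg : g ∈ B) (hg0 : g ≠ 0)
      (hdvd : m.degree g ≤ m.degree f) :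
      DivStep m B (f, s)
        (f - MvPolynomial.monomial (m.degree f - m.degree g)
          (m.leadingCoeff f / m.leadingCoeff g) * g, s)
  | remainder (f s : MvPolynomial σ K) (hf : f ≠ 0)
      (hndvd : ∀ g ∈ B, g ≠ 0 → ¬ m.degree g ≤ m.degree f) :
      DivStep m B (f, s) (f - m.leadingTerm f, s + m.leadingTerm f)

/-- `f'` is a remainder of `f` on division by `B`. -/
def IsRed {K σ : Type*} [Field K] (m : MonomialOrder σ) (B : Finset (MvPolynomial σ K))
    (f f' : MvPolynomial σ K) : Prop :=
  Relation.ReflTransGen (DivStep m B) (f, 0) (0, f')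

/-! ### Reduction by a cone of polynomials -/

/-- The dimensions used for polynomials: one for each monomial (only those other than `1` will
occur), and the additional dimension `none`, the new dimension `T`. -/
abbrev Dim (σ : Type*) := Option (σ →₀ ℕ)

open Classical in
/-- A polynomial as an affine term: each monomial other than `1` is a dimension. -/
noncomputable def toAff {K σ : Type*} [Field K] (f : MvPolynomial σ K) : Aff K (Dim σ) :=
  (∑ μ ∈ f.support.erase 0, Finsupp.single (some μ) (f.coeff μ), f.coeff 0)

/-- The polynomial given by an affine term in which the dimension `none` does not occur. -/
noncomputable def ofAff {K σ : Type*} [Field K] (e : Aff K (Dim σ)) : MvPolynomial σ K :=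
  e.1.sum (fun d a => d.elim 0 (fun μ => MvPolynomial.monomial μ a)) + MvPolynomial.C e.2

/-- The polyhedron `{q_1 ≥ 0, …, q_r ≥ 0}` over the monomials. -/
noncomputable def monomialPolyhedron {K σ : Type*} [Field K] {r : ℕ}
    (q : Fin r → MvPolynomial σ K) : Set (Constraint K (Dim σ)) :=
  Set.range (fun i => Constraint.ge (toAff (q i)))

/-- `ds` lists the monomials other than `1` of `t` and of the `q i`, from greatest to smallest. -/
def IsDimList {K σ : Type*} [Field K] (m : MonomialOrder σ) {r : ℕ}
    (q : Fin r → MvPolynomial σ K) (t : MvPolynomial σ K) (ds : List (σ →₀ ℕ)) : Prop :=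
  ds.Pairwise (fun a b => b ≺[m] a) ∧
    ∀ μ, μ ∈ ds ↔ μ ≠ 0 ∧ (μ ∈ t.support ∨ ∃ i, μ ∈ (q i).support)

/-- `IsCred m p q t tstar`: `tstar` is a result of reducing `t` by the cone of polynomials
`⟨p_1, …, p_k⟩ + [q_1, …, q_r, 1]` with respect to the monomial order `m`. -/
def IsCred {K σ : Type*} [Field K] [LinearOrder K] (m : MonomialOrder σ) {k r : ℕ}
    (p : Fin k → MvPolynomial σ K) (q : Fin r → MvPolynomial σ K) (t tstar : MvPolynomial σ K) :
    Prop :=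
  ∃ B : Finset (MvPolynomial σ K), IsGroebnerBasis m B (Ideal.span (Set.range p)) ∧
    ∃ q' : Fin r → MvPolynomial σ K, (∀ i, IsRed m B (q i) (q' i)) ∧
    ∃ t', IsRed m B t t' ∧
    ∃ ds, IsDimList m q' t' ds ∧
    ∃ u, PolyReduce none (monomialPolyhedron q') (toAff t') (ds.map some) u ∧ tstar = ofAff u

/-- Every run of the reduction procedure is finite: a Gröbner basis exists, every run of the
division algorithm by a Gröbner basis is finite, and so is every run of the main loop of the
subsequent polyhedral reduction. -/
def CredTerminates {K σ : Type*} [Field K] [LinearOrder K] (m : MonomialOrder σ) {k r : ℕ}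
    (p : Fin k → MvPolynomial σ K) (q : Fin r → MvPolynomial σ K) (t : MvPolynomial σ K) : Prop :=
  (∃ B : Finset (MvPolynomial σ K), IsGroebnerBasis m B (Ideal.span (Set.range p))) ∧
  ∀ B : Finset (MvPolynomial σ K), IsGroebnerBasis m B (Ideal.span (Set.range p)) →
    (∀ f, Terminates (DivStep m B) (f, 0)) ∧
    ∀ (q' : Fin r → MvPolynomial σ K) (t' : MvPolynomial σ K) (ds : List (σ →₀ ℕ)),
      (∀ i, IsRed m B (q i) (q' i)) → IsRed m B t t' → IsDimList m q' t' ds →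
      Terminates (ReduceStep none (withTarget none (monomialPolyhedron q') (toAff t'))
        (ds.map some)) ∅

end PolyCone

namespace PolyCone

/-! ### Affine terms -/

/-! Remainders modulo a Gröbner basis are unique normal forms (`IsGroebnerBasis.eq_zero`), so
membership in the cone of polynomials becomes membership of a remainder in the polyhedral cone of
the remainders `q'` and `1`. By Farkas' lemma (`Aff.mem_cone_of_nonneg`), on a non-empty polyhedron
`u - t'` lies in that cone exactly when `T ≤ u` is implied. Correctness thus concerns implied upper
bounds on `T`.

Optimality: a local projection with respect to `v` still contains `v` and lies inside the true
projection. An implied bound free of the projected dimensions therefore survives, and since the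
local projection has a model, some constraint must then bound `T` explicitly
(`LocalProjs.boundsOn_nonempty`). If projecting `d` after `l₁` destroys all bounds, every implied
bound uses a dimension in `l₁ ++ [d]`, whereas conjectured bounds avoid `l₁` (`Conjecture.optimal`).

Termination: division lowers the leading monomial. In polyhedral reduction only finitely many bounds
can be conjectured, whatever the model (`finite_conjecturable`), and each iteration adds a new one,
because the sample violates the old bounds and satisfies the conjectured ones.

Existence of a result is the delicate point: some sample must yield a valid bound
(`exists_conjecture_valid`). Let `l₁` be the longest prefix of the dimensions avoided by some
implied bound. Choose a model at which `T` exceeds all conjecturable bounds that avoid more than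
`l₁`, so that conjecturing stops exactly after `l₁`, and which is generic with respect to
differences of conjecturable bounds and bounds in the exact projection. Raise `T` there to a bound
`u'` of the exact projection. A conjectured bound `u` then agrees with `u'` at the sample, hence by
genericity on the whole polyhedron, so it is valid. -/

theorem exists_eq_off {K D : Type*} (x : D) (v : D → K) (a : K) :
    ∃ w : D → K, (∀ y, y ≠ x → w y = v y) ∧ w x = a := by
  classical
  exact ⟨Function.update v x a, fun y hy => Function.update_of_ne hy _ _, by simp⟩

section Affine

variable {K D : Type*} [Field K]

theorem Aff.eval_eq (e : Aff K D) (v : D → K) :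
    e.eval v = Finsupp.linearCombination K v e.1 + e.2 := by
  simp [Aff.eval, Finsupp.linearCombination_apply]

theorem Aff.eval_add (e f : Aff K D) (v : D → K) : (e + f).eval v = e.eval v + f.eval v := by
  simp only [Aff.eval_eq, Prod.fst_add, Prod.snd_add, map_add]; ring

theorem Aff.eval_neg (e : Aff K D) (v : D → K) : (-e).eval v = -e.eval v := by
  simp only [Aff.eval_eq, Prod.fst_neg, Prod.snd_neg, map_neg]; ring

theorem Aff.eval_sub (e f : Aff K D) (v : D → K) : (e - f).eval v = e.eval v - f.eval v := by
  rw [sub_eq_add_neg, Aff.eval_add, Aff.eval_neg, sub_eq_add_neg]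

theorem Aff.eval_smul (a : K) (e : Aff K D) (v : D → K) : (a • e).eval v = a * e.eval v := by
  simp only [Aff.eval_eq, Prod.smul_fst, Prod.smul_snd, map_smul, smul_eq_mul]; ring

theorem Aff.eval_dim (x : D) (v : D → K) : (Aff.dim x : Aff K D).eval v = v x := by
  simp [Aff.eval_eq, Aff.dim]

theorem Aff.eval_drop (x : D) (e : Aff K D) (v : D → K) :
    (Aff.drop x e).eval v = e.eval v - Aff.coeff x e * v x := by
  rw [Aff.drop, Aff.eval_sub, Aff.eval_smul, Aff.eval_dim]

theorem Aff.eval_solve (x : D) (e : Aff K D) (v : D → K) :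
    (Aff.solve x e).eval v = -((Aff.coeff x e)⁻¹ * (e.eval v - Aff.coeff x e * v x)) := by
  rw [Aff.solve, Aff.eval_neg, Aff.eval_smul, Aff.eval_drop]

theorem Aff.eval_subst (x : D) (e c : Aff K D) (v : D → K) :
    (Aff.subst x e c).eval v = c.eval v + Aff.coeff x c * (e.eval v - v x) := by
  rw [Aff.subst, Aff.eval_add, Aff.eval_smul, Aff.eval_drop]; ring

theorem Aff.coeff_add (y : D) (e f : Aff K D) :
    Aff.coeff y (e + f) = Aff.coeff y e + Aff.coeff y f := rfl

theorem Aff.coeff_sub (y : D) (e f : Aff K D) :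
    Aff.coeff y (e - f) = Aff.coeff y e - Aff.coeff y f := by
  simp [Aff.coeff]

theorem Aff.coeff_neg (y : D) (e : Aff K D) : Aff.coeff y (-e) = -Aff.coeff y e := rfl

theorem Aff.coeff_smul (y : D) (a : K) (e : Aff K D) :
    Aff.coeff y (a • e) = a * Aff.coeff y e := rfl

theorem Aff.coeff_dim_self (x : D) : Aff.coeff x (Aff.dim x : Aff K D) = 1 := by
  simp [Aff.coeff, Aff.dim]

theorem Aff.coeff_dim_of_ne {x y : D} (h : y ≠ x) : Aff.coeff y (Aff.dim x : Aff K D) = 0 := by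
  simp [Aff.coeff, Aff.dim, h]

theorem Aff.coeff_drop_self (x : D) (e : Aff K D) : Aff.coeff x (Aff.drop x e) = 0 := by
  simp [Aff.drop, Aff.coeff_sub, Aff.coeff_smul, Aff.coeff_dim_self]

theorem Aff.coeff_drop {y : D} (x : D) {e : Aff K D} (h : Aff.coeff y e = 0) :
    Aff.coeff y (Aff.drop x e) = 0 := by
  rcases eq_or_ne y x with rfl | hyx
  · exact Aff.coeff_drop_self _ _
  · simp [Aff.drop, Aff.coeff_sub, Aff.coeff_smul, Aff.coeff_dim_of_ne hyx, h]

theorem Aff.coeff_solve_self (x : D) (e : Aff K D) : Aff.coeff x (Aff.solve x e) = 0 := by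
  simp [Aff.solve, Aff.coeff_neg, Aff.coeff_smul, Aff.coeff_drop_self]

theorem Aff.coeff_solve {y : D} (x : D) {e : Aff K D} (h : Aff.coeff y e = 0) :
    Aff.coeff y (Aff.solve x e) = 0 := by
  simp [Aff.solve, Aff.coeff_neg, Aff.coeff_smul, Aff.coeff_drop x h]

theorem Aff.coeff_subst_self {x : D} {e : Aff K D} (c : Aff K D) (h : Aff.coeff x e = 0) :
    Aff.coeff x (Aff.subst x e c) = 0 := by
  simp [Aff.subst, Aff.coeff_add, Aff.coeff_smul, Aff.coeff_drop_self, h]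

theorem Aff.coeff_subst {x y : D} {e c : Aff K D} (he : Aff.coeff y e = 0)
    (hc : Aff.coeff y c = 0) : Aff.coeff y (Aff.subst x e c) = 0 := by
  simp [Aff.subst, Aff.coeff_add, Aff.coeff_smul, Aff.coeff_drop x hc, he]

theorem Aff.eval_congr {e : Aff K D} {v w : D → K}
    (h : ∀ d, Aff.coeff d e ≠ 0 → v d = w d) : e.eval v = e.eval w := by
  unfold Aff.eval
  congr 1
  exact Finset.sum_congr rfl fun d hd => congrArg _ (h d (Finsupp.mem_support_iff.mp hd))

theorem Aff.eval_eq_of_eq_off {x : D} {v w : D → K} (h : ∀ y, y ≠ x → w y = v y) (e : Aff K D) :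
    e.eval w = e.eval v + Aff.coeff x e * (w x - v x) := by
  have := Aff.eval_congr (e := Aff.drop x e) (v := w) (w := v) fun d hd => h d fun hdx => hd <| by
    rw [hdx]; exact Aff.coeff_drop_self _ _
  rw [Aff.eval_drop, Aff.eval_drop] at this
  linear_combination this

theorem Aff.eval_eq_of_eq_off_of_coeff {x : D} {v w : D → K} (h : ∀ y, y ≠ x → w y = v y)
    {e : Aff K D} (he : Aff.coeff x e = 0) : e.eval w = e.eval v := by
  rw [Aff.eval_eq_of_eq_off h, he]; ring

/-- The value of an affine term at a point on a line. -/
theorem Aff.eval_lineMap (e : Aff K D) (v w : D → K) (s : K) :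
    e.eval (fun d => v d + s * (w d - v d)) = e.eval v + s * (e.eval w - e.eval v) := by
  have : ∀ l : D →₀ K, Finsupp.linearCombination K (fun d => v d + s * (w d - v d)) l =
      Finsupp.linearCombination K v l +
        s * (Finsupp.linearCombination K w l - Finsupp.linearCombination K v l) := by
    intro l
    induction l using Finsupp.induction_linear with
    | zero => simp
    | add f g hf hg => rw [map_add, map_add, map_add, hf, hg]; ring
    | single d a => simp; ring
  rw [Aff.eval_eq, Aff.eval_eq, Aff.eval_eq, this]; ring

/-- The homogenization of an affine term, as a linear form. -/
noncomputable def Aff.homog (e : Aff K D) : ((D → K) × K) →ₗ[K] K where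
  toFun w := e.1.sum (fun d a => a * w.1 d) + e.2 * w.2
  map_add' w w' := by
    simp only [Prod.fst_add, Prod.snd_add, Pi.add_apply, mul_add, Finsupp.sum_add]; ring
  map_smul' s w := by
    simp only [Prod.smul_fst, Prod.smul_snd, Pi.smul_apply, smul_eq_mul, Finsupp.sum,
      RingHom.id_apply, mul_add, Finset.mul_sum]
    congr 1
    · exact Finset.sum_congr rfl fun d _ => by ring
    · ring

theorem Aff.homog_apply (e : Aff K D) (w : (D → K) × K) :
    e.homog w = Finsupp.linearCombination K w.1 e.1 + e.2 * w.2 := by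
  simp [Aff.homog, Finsupp.linearCombination_apply]

theorem Aff.homog_one (e : Aff K D) (v : D → K) : e.homog (v, 1) = e.eval v := by
  rw [Aff.homog_apply, Aff.eval_eq, mul_one]

/-- Evaluation at the unit vectors recovers all coefficients. This turns the identity of linear
forms supplied by Farkas' lemma into an identity of affine terms. -/
theorem Aff.homog_injective :
    Function.Injective (Aff.homog : Aff K D → ((D → K) × K) →ₗ[K] K) := by
  classical
  intro e f h
  refine Prod.ext (Finsupp.ext fun d => ?_) ?_
  · have key : ∀ l : D →₀ K, Finsupp.linearCombination K (Pi.single d (1 : K)) l = l d := by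
      intro l
      induction l using Finsupp.induction_linear with
      | zero => simp
      | add f g hf hg => rw [map_add, hf, hg]; rfl
      | single d' a =>
        rcases eq_or_ne d' d with rfl | hd
        · simp
        · simp [hd]
    have := LinearMap.congr_fun h (Pi.single d 1, 0)
    simpa [Aff.homog_apply, key] using this
  · have key : ∀ l : D →₀ K, Finsupp.linearCombination K (0 : D → K) l = 0 := fun l => by
      simp
    have := LinearMap.congr_fun h (0, 1)
    simpa [Aff.homog_apply, key] using this

theorem Aff.homog_of_ne_zero (e : Aff K D) (v : D → K) {s : K} (hs : s ≠ 0) :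
    e.homog (v, s) = s * e.eval (s⁻¹ • v) := by
  rw [← Aff.homog_one, ← smul_eq_mul, ← map_smul]
  congr 1
  ext <;> simp [hs]

end Affine

/-! ### Farkas' lemma -/

section Farkas

variable {K : Type*} [Field K] [LinearOrder K] [IsStrictOrderedRing K]

/-- Farkas' lemma over an ordered field, in a vector space of arbitrary dimension. -/
theorem farkas {W : Type*} [AddCommGroup W] [Module K W] {n : ℕ} (A : Fin n → W →ₗ[K] K)
    (b : W →ₗ[K] K) (h : ∀ x, (∀ i, 0 ≤ A i x) → 0 ≤ b x) :
    ∃ c : Fin n → K, (∀ i, 0 ≤ c i) ∧ b = ∑ i, c i • A i := by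
  induction n generalizing b with
  | zero =>
    refine ⟨0, fun i => i.elim0, LinearMap.ext fun x => ?_⟩
    have h1 := h x fun i => i.elim0
    have h2 := h (-x) fun i => i.elim0
    rw [map_neg] at h2
    simpa using le_antisymm (by linarith) h1
  | succ n ih =>
    -- Either the last form is superfluous, or some `z` satisfies the other inequalities with `b z <
    -- 0`, and then the last form is negative at `z`.
    by_cases h' : ∀ x, (∀ i : Fin n, 0 ≤ A i.castSucc x) → 0 ≤ b x
    · obtain ⟨c, hc, hb⟩ := ih _ b h'
      refine ⟨Fin.snoc c 0, fun i => ?_, ?_⟩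
      · induction i using Fin.lastCases <;> simp [hc]
      · simpa [Fin.sum_univ_castSucc] using hb
    push Not at h'
    obtain ⟨z, hz, hbz⟩ := h'
    have haz : A (Fin.last n) z < 0 := by
      by_contra! haz
      refine (h z fun i => ?_).not_gt hbz
      induction i using Fin.lastCases with
      | last => exact haz
      | cast i => exact hz i
    set a := A (Fin.last n)
    -- These are the pullbacks of the forms along the projection `x ↦ x - (a x / a z) • z` onto the
    -- kernel of `a`, where the last inequality holds trivially.
    obtain ⟨c, hc, hb⟩ := ih (fun i => A i.castSucc - (A i.castSucc z / a z) • a)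
      (b - (b z / a z) • a) fun x hx => by
        have := h (x - (a x / a z) • z) fun i => by
          induction i using Fin.lastCases with
          | last =>
            change 0 ≤ a (x - (a x / a z) • z)
            rw [map_sub, map_smul, smul_eq_mul, div_mul_cancel₀ _ haz.ne, sub_self]
          | cast i =>
            have := hx i
            simp only [LinearMap.sub_apply, LinearMap.smul_apply, map_sub, map_smul,
              smul_eq_mul] at this ⊢
            convert this using 2
            ring
        simp only [LinearMap.sub_apply, LinearMap.smul_apply, map_sub, map_smul,
          smul_eq_mul] at this ⊢
        convert this using 2
        ring
    -- The last coefficient collects the multiples of `a`; its numerator and denominator are both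
    -- negative.
    refine ⟨Fin.snoc c ((b z - ∑ i, c i * A i.castSucc z) / a z), fun i => ?_, ?_⟩
    · induction i using Fin.lastCases with
      | last =>
        rw [Fin.snoc_last]
        refine div_nonneg_of_nonpos ?_ haz.le
        have := Finset.sum_nonneg fun i (_ : i ∈ Finset.univ) => mul_nonneg (hc i) (hz i)
        linarith
      | cast i => simpa using hc i
    · refine LinearMap.ext fun x => ?_
      have key : ∑ i, c i * (A i.castSucc x - A i.castSucc z / a z * a x) =
          ∑ i, c i * A i.castSucc x - (∑ i, c i * A i.castSucc z) / a z * a x := by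
        rw [Finset.sum_div, Finset.sum_mul, ← Finset.sum_sub_distrib]
        exact Finset.sum_congr rfl fun i _ => by ring
      have hx := LinearMap.congr_fun hb x
      simp only [LinearMap.sub_apply, LinearMap.smul_apply, LinearMap.sum_apply, smul_eq_mul,
        key] at hx
      simp only [Fin.sum_univ_castSucc, Fin.snoc_castSucc, Fin.snoc_last, LinearMap.add_apply,
        LinearMap.smul_apply, LinearMap.sum_apply, smul_eq_mul]
      change _ = _ + _ * a x
      linear_combination hx

/-- The affine combinations that are nonnegative for a homogeneous reason. -/
theorem Aff.mem_cone_of_homog {D : Type*} {n : ℕ} (S : Fin n → Aff K D) (f : Aff K D)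
    (h : ∀ w s, 0 ≤ s → (∀ i, 0 ≤ (S i).homog (w, s)) → 0 ≤ f.homog (w, s)) :
    f ∈ polyhedralCone K (Fin.snoc S (0, 1) : Fin (n + 1) → Aff K D) := by
  obtain ⟨c, hc, hf⟩ := farkas
    (fun i => ((Fin.snoc S (0, 1) : Fin (n + 1) → Aff K D) i).homog) f.homog fun x hx => by
      refine h x.1 x.2 ?_ fun i => ?_
      · have := hx (Fin.last n)
        simpa [Aff.homog_apply] using this
      · simpa using hx i.castSucc
  refine ⟨c, hc, Aff.homog_injective ?_⟩
  rw [hf]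
  ext x <;> simp [Aff.homog_apply, Prod.fst_sum, Prod.snd_sum]

/-- The affine form of Farkas' lemma for a non-empty polyhedron. -/
theorem Aff.mem_cone_of_nonneg {D : Type*} {n : ℕ} (S : Fin n → Aff K D) (f : Aff K D)
    (p : D → K) (hp : ∀ i, 0 ≤ (S i).eval p)
    (h : ∀ w, (∀ i, 0 ≤ (S i).eval w) → 0 ≤ f.eval w) :
    f ∈ polyhedralCone K (Fin.snoc S (0, 1) : Fin (n + 1) → Aff K D) := by
  refine Aff.mem_cone_of_homog S f fun w s hs hw => ?_
  rcases hs.eq_or_lt with rfl | hs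
  · by_contra! hneg
    have key : ∀ a : K, ∀ e : Aff K D, e.eval (p + a • w) = e.eval p + a * e.homog (w, 0) := by
      intro a e
      rw [← Aff.homog_one, ← Aff.homog_one, ← smul_eq_mul, ← map_smul, ← map_add]
      congr 1
      ext <;> simp
    -- Here `w` is a recession direction along which `f` decreases; the step length is chosen so
    -- that `f` takes the value `-1` at `p + a • w`, a point of the polyhedron.
    set a := (f.eval p + 1) / -f.homog (w, 0)
    have hpos : 0 ≤ f.eval p := h p hp
    have ha : 0 ≤ a := div_nonneg (by linarith) (by linarith)
    have := h (p + a • w) fun i => by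
      rw [key]; exact add_nonneg (hp i) (mul_nonneg ha (hw i))
    rw [key] at this
    have h2 : a * f.homog (w, 0) = -(f.eval p + 1) := by
      simp only [a]; rw [div_neg, neg_mul, div_mul_cancel₀ _ hneg.ne]
    linarith
  · rw [Aff.homog_of_ne_zero f w hs.ne']
    refine mul_nonneg hs.le (h _ fun i => ?_)
    have := hw i
    rw [Aff.homog_of_ne_zero _ w hs.ne'] at this
    exact nonneg_of_mul_nonneg_right this hs

/-- The affine form of Farkas' lemma for an empty polyhedron. -/
theorem Aff.neg_one_mem_cone {D : Type*} {n : ℕ} (S : Fin n → Aff K D)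
    (h : ¬ ∃ w, ∀ i, 0 ≤ (S i).eval w) :
    (0, -1) ∈ polyhedralCone K (Fin.snoc S (0, 1) : Fin (n + 1) → Aff K D) := by
  refine Aff.mem_cone_of_homog S _ fun w s hs hw => ?_
  rcases hs.eq_or_lt with rfl | hs
  · simp [Aff.homog_apply]
  · refine absurd ⟨s⁻¹ • w, fun i => ?_⟩ h
    have := hw i
    rw [Aff.homog_of_ne_zero _ w hs.ne'] at this
    exact nonneg_of_mul_nonneg_right this hs

end Farkas

/-! ### Local projections -/

section Projection

variable {K D : Type*} [Field K]

/-- The dimension `y` does not occur in the constraints of `P`. -/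
def IsFree (y : D) (P : Set (Constraint K D)) : Prop :=
  ∀ c ∈ P, Aff.coeff y c.term = 0

theorem coeff_eqTerms {x : D} {P : Set (Constraint K D)} {e : Aff K D} (he : e ∈ eqTerms x P) :
    Aff.coeff x e = 0 := by
  obtain ⟨c, -, -, rfl⟩ := he; exact Aff.coeff_solve_self _ _

theorem IsFree.coeff_eqTerms {x y : D} {P : Set (Constraint K D)} (hy : IsFree y P) {e : Aff K D}
    (he : e ∈ eqTerms x P) : Aff.coeff y e = 0 := by
  obtain ⟨c, hc, -, rfl⟩ := he; exact Aff.coeff_solve _ (hy _ hc)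

theorem finite_eqTerms (x : D) {P : Set (Constraint K D)} (hP : P.Finite) :
    (eqTerms x P).Finite :=
  (hP.image fun c : Constraint K D => Aff.solve x c.term).subset <| by
    rintro e ⟨c, hc, -, rfl⟩; exact ⟨_, hc, rfl⟩

variable [LinearOrder K]

theorem IsModel.eval_eqTerms {v : D → K} {P : Set (Constraint K D)} (hv : IsModel v P) {x : D}
    {e : Aff K D} (he : e ∈ eqTerms x P) : e.eval v = v x := by
  obtain ⟨c, hc, hx, rfl⟩ := he
  have : c.eval v = 0 := hv _ hc
  rw [Aff.eval_solve, this]; field_simp; ring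

theorem finite_lowerTerms (x : D) {P : Set (Constraint K D)} (hP : P.Finite) :
    (lowerTerms x P).Finite :=
  (hP.image fun c : Constraint K D => Aff.solve x c.term).subset <| by
    rintro e ⟨c, hc, -, rfl⟩; exact ⟨_, hc, rfl⟩

theorem finite_upperTerms (x : D) {P : Set (Constraint K D)} (hP : P.Finite) :
    (upperTerms x P).Finite :=
  (hP.image fun c : Constraint K D => Aff.solve x c.term).subset <| by
    rintro e ⟨c, hc, -, rfl⟩; exact ⟨_, hc, rfl⟩

theorem finite_boundsOn (x : D) {P : Set (Constraint K D)} (hP : P.Finite) :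
    (boundsOn x P).Finite :=
  (finite_upperTerms x hP).union (finite_eqTerms x hP)

theorem coeff_lowerTerms {x : D} {P : Set (Constraint K D)} {e : Aff K D}
    (he : e ∈ lowerTerms x P) : Aff.coeff x e = 0 := by
  obtain ⟨c, -, -, rfl⟩ := he; exact Aff.coeff_solve_self _ _

theorem coeff_upperTerms {x : D} {P : Set (Constraint K D)} {e : Aff K D}
    (he : e ∈ upperTerms x P) : Aff.coeff x e = 0 := by
  obtain ⟨c, -, -, rfl⟩ := he; exact Aff.coeff_solve_self _ _

theorem coeff_boundsOn {x : D} {P : Set (Constraint K D)} {e : Aff K D}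
    (he : e ∈ boundsOn x P) : Aff.coeff x e = 0 :=
  he.elim coeff_upperTerms coeff_eqTerms

theorem IsFree.coeff_lowerTerms {x y : D} {P : Set (Constraint K D)} (hy : IsFree y P)
    {e : Aff K D} (he : e ∈ lowerTerms x P) : Aff.coeff y e = 0 := by
  obtain ⟨c, hc, -, rfl⟩ := he; exact Aff.coeff_solve _ (hy _ hc)

theorem IsFree.coeff_upperTerms {x y : D} {P : Set (Constraint K D)} (hy : IsFree y P)
    {e : Aff K D} (he : e ∈ upperTerms x P) : Aff.coeff y e = 0 := by
  obtain ⟨c, hc, -, rfl⟩ := he; exact Aff.coeff_solve _ (hy _ hc)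

theorem IsFree.coeff_boundsOn {x y : D} {P : Set (Constraint K D)} (hy : IsFree y P)
    {e : Aff K D} (he : e ∈ boundsOn x P) : Aff.coeff y e = 0 :=
  he.elim hy.coeff_upperTerms hy.coeff_eqTerms

theorem LocalProj.isFree {v : D → K} {P P' : Set (Constraint K D)} {x y : D}
    (h : LocalProj v P x P') (hy : y = x ∨ IsFree y P) : IsFree y P' := by
  have hE : ∀ e ∈ eqTerms x P, Aff.coeff y e = 0 := fun e he =>
    hy.elim (fun h => h ▸ coeff_eqTerms he) fun h => h.coeff_eqTerms he
  have hL : ∀ e ∈ lowerTerms x P, Aff.coeff y e = 0 := fun e he =>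
    hy.elim (fun h => h ▸ coeff_lowerTerms he) fun h => h.coeff_lowerTerms he
  have hU : ∀ e ∈ upperTerms x P, Aff.coeff y e = 0 := fun e he =>
    hy.elim (fun h => h ▸ coeff_upperTerms he) fun h => h.coeff_upperTerms he
  have hF : ∀ c ∈ freeConstraints x P, Aff.coeff y c.term = 0 := fun c hc =>
    hy.elim (fun h => h ▸ hc.2) fun h => h c hc.1
  have hS : ∀ e c : Aff K D, Aff.coeff y e = 0 → (y = x ∨ Aff.coeff y c = 0) →
      Aff.coeff y (Aff.subst x e c) = 0 := by
    rintro e c he (rfl | hc)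
    · exact Aff.coeff_subst_self c he
    · exact Aff.coeff_subst he hc
  cases h with
  | equality e he =>
    rintro _ ⟨c, hc, rfl⟩
    cases c with
    | eq c => exact hS _ _ (hE e he) (hy.imp_right fun h => h _ hc)
    | ge c => exact hS _ _ (hE e he) (hy.imp_right fun h => h _ hc)
  | noLower _ _ => exact hF
  | lower _ lb hlb _ =>
    rintro c ((⟨l, hl, rfl⟩ | ⟨u, hu, rfl⟩) | hc)
    · simp [Constraint.term, Aff.coeff_sub, hL _ hlb, hL _ hl]
    · simp [Constraint.term, Aff.coeff_sub, hL _ hlb, hU _ hu]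
    · exact hF c hc

/-- The model only selects among finitely many substitutions and lower bounds read off from `P`;
uniformity in `v` is what termination rests on. -/
theorem finite_localProj (x : D) {P : Set (Constraint K D)} (hP : P.Finite) :
    {P' | ∃ v, LocalProj v P x P'}.Finite := by
  refine Set.Finite.subset ((((finite_eqTerms x hP).image fun e =>
    Constraint.subst x e '' P).union (Set.finite_singleton (freeConstraints x P))).union
    ((finite_lowerTerms x hP).image fun lb => {c | ∃ l ∈ lowerTerms x P, c = Constraint.ge (lb - l)} ∪
          {c | ∃ u ∈ upperTerms x P, c = Constraint.ge (u - lb)} ∪ freeConstraints x P)) ?_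
  rintro P' ⟨v, h⟩
  cases h with
  | equality e he => exact Or.inl (Or.inl ⟨e, he, rfl⟩)
  | noLower _ _ => exact Or.inl (Or.inr rfl)
  | lower _ lb hlb _ => exact Or.inr ⟨lb, hlb, rfl⟩

theorem LocalProj.finite {v : D → K} {P P' : Set (Constraint K D)} {x : D}
    (h : LocalProj v P x P') (hP : P.Finite) : P'.Finite := by
  cases h with
  | equality e he => exact hP.image _
  | noLower _ _ => exact hP.subset fun c hc => hc.1
  | lower _ lb hlb _ =>
    refine (Set.Finite.union ?_ ?_).union (hP.subset fun c hc => hc.1)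
    · exact ((finite_lowerTerms x hP).image fun l => Constraint.ge (lb - l)).subset
        fun c ⟨l, hl, h⟩ => ⟨l, hl, h.symm⟩
    · exact ((finite_upperTerms x hP).image fun u => Constraint.ge (u - lb)).subset
        fun c ⟨l, hl, h⟩ => ⟨l, hl, h.symm⟩

theorem exists_localProj (v : D → K) {P : Set (Constraint K D)} (hP : P.Finite) (x : D) :
    ∃ P', LocalProj v P x P' := by
  rcases (eqTerms x P).eq_empty_or_nonempty with hE | ⟨e, he⟩
  · rcases (lowerTerms x P).eq_empty_or_nonempty with hL | hL
    · exact ⟨_, .noLower hE hL⟩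
    · obtain ⟨lb, hlb, hmax⟩ :=
        Set.exists_max_image _ (fun e : Aff K D => e.eval v) (finite_lowerTerms x hP) hL
      exact ⟨_, .lower hE lb hlb hmax⟩
  · exact ⟨_, .equality e he⟩

variable [IsStrictOrderedRing K]

theorem eval_solve_le {x : D} {c : Aff K D} (hx : 0 < Aff.coeff x c) {v : D → K} :
    (Aff.solve x c).eval v ≤ v x ↔ 0 ≤ c.eval v := by
  have : (Aff.solve x c).eval v = v x - c.eval v / Aff.coeff x c := by
    rw [Aff.eval_solve]; field_simp; ring
  rw [this, sub_le_self_iff, le_div_iff₀ hx, zero_mul]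

theorem le_eval_solve {x : D} {c : Aff K D} (hx : Aff.coeff x c < 0) {v : D → K} :
    v x ≤ (Aff.solve x c).eval v ↔ 0 ≤ c.eval v := by
  have : (Aff.solve x c).eval v = v x + c.eval v / -Aff.coeff x c := by
    have := hx.ne
    rw [Aff.eval_solve]; field_simp; ring
  rw [this, le_add_iff_nonneg_right, le_div_iff₀ (neg_pos.2 hx), zero_mul]

theorem IsModel.lowerTerms_le {v : D → K} {P : Set (Constraint K D)} (hv : IsModel v P) {x : D}
    {e : Aff K D} (he : e ∈ lowerTerms x P) : e.eval v ≤ v x := by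
  obtain ⟨c, hc, hx, rfl⟩ := he
  exact (eval_solve_le hx).2 (hv _ hc)

theorem IsModel.le_upperTerms {v : D → K} {P : Set (Constraint K D)} (hv : IsModel v P) {x : D}
    {e : Aff K D} (he : e ∈ upperTerms x P) : v x ≤ e.eval v := by
  obtain ⟨c, hc, hx, rfl⟩ := he
  exact (le_eval_solve hx).2 (hv _ hc)

theorem IsModel.le_boundsOn {v : D → K} {P : Set (Constraint K D)} (hv : IsModel v P) {x : D}
    {e : Aff K D} (he : e ∈ boundsOn x P) : v x ≤ e.eval v :=
  he.elim hv.le_upperTerms fun h => (hv.eval_eqTerms h).ge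

/-- Without equalities that involve `x`, the value at `x` of a model is only restricted by the
lower and upper bounds. -/
theorem IsModel.of_bounds {w w' : D → K} {P : Set (Constraint K D)} {x : D}
    (hw : ∀ y, y ≠ x → w' y = w y) (hF : IsModel w (freeConstraints x P)) (hE : eqTerms x P = ∅)
    (hL : ∀ l ∈ lowerTerms x P, l.eval w ≤ w' x) (hU : ∀ u ∈ upperTerms x P, w' x ≤ u.eval w) :
    IsModel w' P := by
  have hsolve : ∀ c : Aff K D, (Aff.solve x c).eval w' = (Aff.solve x c).eval w := fun c =>
    Aff.eval_eq_of_eq_off_of_coeff hw (Aff.coeff_solve_self _ _)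
  intro c hc
  cases c with
  | eq c =>
    by_cases hx : Aff.coeff x c = 0
    · have : c.eval w = 0 := hF (.eq c) ⟨hc, hx⟩
      rwa [← Aff.eval_eq_of_eq_off_of_coeff hw hx] at this
    · exact (Set.eq_empty_iff_forall_notMem.1 hE _ ⟨c, hc, hx, rfl⟩).elim
  | ge c =>
    rcases lt_trichotomy (Aff.coeff x c) 0 with hx | hx | hx
    · have := hU _ ⟨c, hc, hx, rfl⟩
      rwa [← hsolve, le_eval_solve hx] at this
    · have : 0 ≤ c.eval w := hF (.ge c) ⟨hc, hx⟩
      rwa [← Aff.eval_eq_of_eq_off_of_coeff hw hx] at this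
    · have := hL _ ⟨c, hc, hx, rfl⟩
      rwa [← hsolve, eval_solve_le hx] at this

/-- A local projection with respect to a model is satisfied by that model. -/
theorem LocalProj.isModel {v : D → K} {P P' : Set (Constraint K D)} {x : D}
    (h : LocalProj v P x P') (hv : IsModel v P) : IsModel v P' := by
  cases h with
  | equality e he =>
    rintro _ ⟨c, hc, rfl⟩
    have hc := hv c hc
    cases c with
    | eq c => simpa [Constraint.Holds, Constraint.subst, Aff.eval_subst, hv.eval_eqTerms he] using hc
    | ge c => simpa [Constraint.Holds, Constraint.subst, Aff.eval_subst, hv.eval_eqTerms he] using hc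
  | noLower _ _ => exact fun c hc => hv c hc.1
  | lower _ lb hlb hmax =>
    rintro c ((⟨l, hl, rfl⟩ | ⟨u, hu, rfl⟩) | hc)
    · simpa [Constraint.Holds, Aff.eval_sub] using hmax l hl
    · simpa [Constraint.Holds, Aff.eval_sub] using
        (hv.lowerTerms_le hlb).trans (hv.le_upperTerms hu)
    · exact hv c hc.1

/-- A local projection is contained in the projection. -/
theorem LocalProj.exists_isModel {v : D → K} {P P' : Set (Constraint K D)} {x : D}
    (h : LocalProj v P x P') (hP : P.Finite) {w : D → K} (hw : IsModel w P') :
    ∃ w', (∀ y, y ≠ x → w' y = w y) ∧ IsModel w' P := by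
  cases h with
  | equality e he =>
    obtain ⟨w', hoff, hx⟩ := exists_eq_off x w (e.eval w)
    refine ⟨w', hoff, fun c hc => ?_⟩
    have hc := hw _ ⟨c, hc, rfl⟩
    cases c with
    | eq c =>
      simpa [Constraint.Holds, Constraint.subst, Aff.eval_subst,
        Aff.eval_eq_of_eq_off hoff c, hx] using hc
    | ge c =>
      simpa [Constraint.Holds, Constraint.subst, Aff.eval_subst,
        Aff.eval_eq_of_eq_off hoff c, hx] using hc
  | noLower hE hL =>
    -- Without lower bounds on `x`, any value below all upper bounds will do.
    obtain ⟨a, ha⟩ := ((finite_upperTerms x hP).image fun u : Aff K D => u.eval w).bddBelow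
    obtain ⟨w', hoff, hx⟩ := exists_eq_off x w a
    refine ⟨w', hoff, IsModel.of_bounds hoff hw hE (by simp [hL]) fun u hu => ?_⟩
    rw [hx]
    exact ha ⟨u, hu, rfl⟩
  | lower hE lb hlb hmax =>
    -- The constraints of the local projection say that `lb` itself is an admissible value for `x`.
    obtain ⟨w', hoff, hx⟩ := exists_eq_off x w (lb.eval w)
    refine ⟨w', hoff, IsModel.of_bounds hoff (fun c hc => hw c (Or.inr hc)) hE (fun l hl => ?_)
      fun u hu => ?_⟩
    · have := hw _ (Or.inl (Or.inl ⟨l, hl, rfl⟩))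
      rw [Constraint.Holds, Aff.eval_sub] at this
      rw [hx]; exact sub_nonneg.1 this
    · have := hw _ (Or.inl (Or.inr ⟨u, hu, rfl⟩))
      rw [Constraint.Holds, Aff.eval_sub] at this
      rw [hx]; exact sub_nonneg.1 this

end Projection

/-! ### Terminating procedures -/

/-- Otherwise a choice of successors on the reachable states could be iterated to an infinite
execution. -/
theorem Terminates.exists_normal {S : Type*} {R : S → S → Prop} {a : S} (h : Terminates R a) :
    ∃ b, Relation.ReflTransGen R a b ∧ ¬ ∃ c, R b c := by
  by_contra! hcon
  choose f hf using fun b : {b // Relation.ReflTransGen R a b} => hcon b.1 b.2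
  let g : {b // Relation.ReflTransGen R a b} → {b // Relation.ReflTransGen R a b} :=
    fun b => ⟨f b, b.2.tail (hf b)⟩
  refine h ⟨fun n => (g^[n] ⟨a, .refl⟩).1, rfl, fun n => ?_⟩
  simp only [Function.iterate_succ_apply']
  exact hf _

theorem terminates_of_wellFounded {S : Type*} {R : S → S → Prop} {r : S → S → Prop}
    (hr : WellFounded r) (h : ∀ a b, R a b → r b a) (a : S) : Terminates R a := by
  rintro ⟨s, -, hs⟩
  obtain ⟨b, ⟨n, rfl⟩, hmin⟩ := hr.has_min (Set.range s) ⟨_, 0, rfl⟩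
  exact hmin _ ⟨n + 1, rfl⟩ (h _ _ (hs n))

/-! ### Iterated local projections -/

section Iterated

variable {K D : Type*} [Field K] [LinearOrder K]

/-- `P'` arises from `P` by locally projecting out the dimensions `ds` one after the other. -/
inductive LocalProjs (v : D → K) :
    Set (Constraint K D) → List D → Set (Constraint K D) → Prop
  | nil (P : Set (Constraint K D)) : LocalProjs v P [] P
  | cons {P P' P'' : Set (Constraint K D)} {d : D} {ds : List D} (h : LocalProj v P d P')
      (hs : LocalProjs v P' ds P'') : LocalProjs v P (d :: ds) P''

theorem LocalProjs.concat {v : D → K} {P P' P'' : Set (Constraint K D)} {ds : List D} {d : D}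
    (h : LocalProjs v P ds P') (hd : LocalProj v P' d P'') : LocalProjs v P (ds ++ [d]) P'' := by
  induction h with
  | nil P => exact .cons hd (.nil _)
  | cons h _ ih => exact .cons h (ih hd)

theorem LocalProjs.isFree {v : D → K} {P P' : Set (Constraint K D)} {ds : List D} {y : D}
    (h : LocalProjs v P ds P') (hy : y ∈ ds ∨ IsFree y P) : IsFree y P' := by
  induction h with
  | nil P => simpa using hy
  | cons h _ ih =>
    rcases hy with hy | hy
    · rcases List.mem_cons.1 hy with rfl | hy
      · exact ih (Or.inr (h.isFree (Or.inl rfl)))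
      · exact ih (Or.inl hy)
    · exact ih (Or.inr (h.isFree (Or.inr hy)))

theorem LocalProjs.finite {v : D → K} {P P' : Set (Constraint K D)} {ds : List D}
    (h : LocalProjs v P ds P') (hP : P.Finite) : P'.Finite := by
  induction h with
  | nil P => exact hP
  | cons h _ ih => exact ih (h.finite hP)

/-- A conjectured set of bounds is read off an iterated local projection, which ends with the last
dimension or where the next local projection has no bound on `T` any more. -/
theorem Conjecture.exists_localProjs {v : D → K} {T : D} {P : Set (Constraint K D)} {ds : List D}
    {B : Set (Aff K D)} (h : Conjecture v T P ds B) (hT : (boundsOn T P).Nonempty) :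
    ∃ l₁ l₂ P', ds = l₁ ++ l₂ ∧ LocalProjs v P l₁ P' ∧ B = boundsOn T P' ∧ B.Nonempty ∧
      ∀ d l, l₂ = d :: l → ∃ P'', LocalProj v P' d P'' ∧ boundsOn T P'' = ∅ := by
  induction h with
  | exhausted P => exact ⟨[], [], P, rfl, .nil P, rfl, hT, by simp⟩
  | unbounded P P' d ds h hT' =>
    refine ⟨[], d :: ds, P, rfl, .nil P, rfl, hT, fun d' l hl => ?_⟩
    obtain ⟨rfl, rfl⟩ := List.cons.inj hl
    exact ⟨P', h, hT'⟩
  | project P P' d ds B h hT' _ ih =>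
    obtain ⟨l₁, l₂, Q, rfl, hQ, hB, hne, hl⟩ := ih hT'
    exact ⟨d :: l₁, l₂, Q, rfl, .cons h hQ, hB, hne, hl⟩

theorem exists_conjecture (v : D → K) (T : D) {P : Set (Constraint K D)} (hP : P.Finite)
    (ds : List D) : ∃ B, Conjecture v T P ds B := by
  induction ds generalizing P with
  | nil => exact ⟨_, .exhausted P⟩
  | cons d ds ih =>
    obtain ⟨P', h⟩ := exists_localProj v hP d
    rcases (boundsOn T P').eq_empty_or_nonempty with hT | hT
    · exact ⟨_, .unbounded P P' d ds h hT⟩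
    · obtain ⟨B, hB⟩ := ih (h.finite hP)
      exact ⟨B, .project P P' d ds B h hT hB⟩

theorem finite_conjecture (T : D) {P : Set (Constraint K D)} (hP : P.Finite) (ds : List D) :
    {B | ∃ v, Conjecture v T P ds B}.Finite := by
  induction ds generalizing P with
  | nil =>
    refine (Set.finite_singleton (boundsOn T P)).subset ?_
    rintro B ⟨v, h⟩
    cases h
    rfl
  | cons d ds ih =>
    -- Finiteness of `P'` is built into the indexed sets, since the induction hypothesis is needed
    -- for each of them.
    refine ((Set.finite_singleton (boundsOn T P)).union ((finite_localProj d hP).biUnion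
      (t := fun P' => {B | P'.Finite ∧ ∃ v, Conjecture v T P' ds B}) fun P' _ => ?_)).subset ?_
    · by_cases hP' : P'.Finite
      · exact (ih hP').subset fun B hB => hB.2
      · exact Set.finite_empty.subset fun B hB => hP' hB.1
    · rintro B ⟨v, h⟩
      cases h with
      | unbounded _ P' _ _ h hT => exact Or.inl rfl
      | project _ P' _ _ _ h hT hB =>
        exact Or.inr (Set.mem_biUnion (Set.mem_ofPred.2 ⟨v, h⟩) ⟨h.finite hP, v, hB⟩)

/-- All bounds on `T` that can be conjectured. -/
def conjecturable (T : D) (P : Set (Constraint K D)) (ds : List D) : Set (Aff K D) :=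
  {u | ∃ v B, Conjecture v T P ds B ∧ u ∈ B}

theorem finite_conjecturable (T : D) {P : Set (Constraint K D)} (hP : P.Finite) (ds : List D) :
    (conjecturable T P ds).Finite := by
  refine ((finite_conjecture T hP ds).biUnion (t := fun B => {u | B.Finite ∧ u ∈ B})
    fun B _ => ?_).subset ?_
  · by_cases hB : B.Finite
    · exact hB.subset fun u hu => hu.2
    · exact Set.finite_empty.subset fun u hu => hB hu.1
  · rintro u ⟨v, B, h, hu⟩
    refine Set.mem_biUnion (Set.mem_ofPred.2 ⟨v, h⟩) ⟨?_, hu⟩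
    clear hu
    induction h with
    | exhausted P => exact finite_boundsOn T hP
    | unbounded P P' d ds h hT => exact finite_boundsOn T hP
    | project P P' d ds B h hT hB ih => exact ih (h.finite hP)

theorem Conjecture.isFree {v : D → K} {T : D} {P : Set (Constraint K D)} {ds : List D}
    {B : Set (Aff K D)} (h : Conjecture v T P ds B) (hT : (boundsOn T P).Nonempty)
    {u : Aff K D} (hu : u ∈ B) {y : D} (hy : y = T ∨ IsFree y P) : Aff.coeff y u = 0 := by
  obtain ⟨l₁, l₂, P', -, hP', rfl, -, -⟩ := h.exists_localProjs hT
  rcases hy with rfl | hy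
  · exact coeff_boundsOn hu
  · exact (hP'.isFree (Or.inr hy)).coeff_boundsOn hu

/-- Bounds can be conjectured from any point, so the loop gets stuck only for lack of a sample;
normal forms of `ReduceStep` are ends of complete runs. -/
theorem reduceStep_iff_exists_isSample {T : D} {P : Set (Constraint K D)} (hP : P.Finite)
    (ds : List D) (U : Set (Aff K D)) :
    (∃ U', ReduceStep T P ds U U') ↔ ∃ v, IsSample T P U v := by
  refine ⟨fun ⟨U', v, hv, _⟩ => ⟨v, hv⟩, fun ⟨v, hv⟩ => ?_⟩
  obtain ⟨B, hB⟩ := exists_conjecture v T hP ds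
  exact ⟨_, v, hv, B, hB, rfl⟩

/-- Every bound that was found was conjectured from some model. -/
theorem exists_conjecture_of_reflTransGen {T : D} {P : Set (Constraint K D)} {ds : List D}
    {U : Set (Aff K D)} (h : Relation.ReflTransGen (ReduceStep T P ds) ∅ U) {u : Aff K D}
    (hu : u ∈ U) : ∃ v B, IsModel v P ∧ Conjecture v T P ds B ∧ u ∈ B := by
  induction h with
  | refl => exact hu.elim
  | tail _ h ih =>
    obtain ⟨v, hv, B, hB, rfl⟩ := h
    exact hu.elim ih fun hu => ⟨v, B, hv.1, hB, hu⟩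

variable [IsStrictOrderedRing K]

theorem LocalProjs.isModel {v : D → K} {P P' : Set (Constraint K D)} {ds : List D}
    (h : LocalProjs v P ds P') (hv : IsModel v P) : IsModel v P' := by
  induction h with
  | nil P => exact hv
  | cons h _ ih => exact ih (h.isModel hv)

theorem LocalProjs.exists_isModel {v : D → K} {P P' : Set (Constraint K D)} {ds : List D}
    (h : LocalProjs v P ds P') (hP : P.Finite) {w : D → K} (hw : IsModel w P') :
    ∃ w', (∀ y, y ∉ ds → w' y = w y) ∧ IsModel w' P := by
  induction h with
  | nil P => exact ⟨w, fun _ _ => rfl, hw⟩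
  | cons h _ ih =>
    obtain ⟨w₁, h₁, hw₁⟩ := ih (h.finite hP) hw
    obtain ⟨w₂, h₂, hw₂⟩ := h.exists_isModel hP hw₁
    refine ⟨w₂, fun y hy => ?_, hw₂⟩
    rw [List.mem_cons, not_or] at hy
    rw [h₂ y hy.1, h₁ y hy.2]

/-- If `T` has no upper bound in the constraints, it can be increased arbitrarily. -/
theorem IsModel.exists_raise_of_unbounded {P : Set (Constraint K D)} {T : D}
    (hT : boundsOn T P = ∅) {w : D → K} (hw : IsModel w P) {a : K} (ha : w T ≤ a) :
    ∃ w', (∀ y, y ≠ T → w' y = w y) ∧ w' T = a ∧ IsModel w' P := by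
  obtain ⟨w', hoff, rfl⟩ := exists_eq_off T w a
  rw [boundsOn, Set.union_empty_iff] at hT
  exact ⟨w', hoff, rfl, IsModel.of_bounds hoff (fun c hc => hw c hc.1) hT.2
    (fun l hl => (hw.lowerTerms_le hl).trans ha) (by simp [hT.1])⟩

/-- `T` can be increased until it equals one of its upper bounds. -/
theorem IsModel.exists_raise {P : Set (Constraint K D)} (hP : P.Finite) {T : D}
    (hT : (boundsOn T P).Nonempty) {w : D → K} (hw : IsModel w P) :
    ∃ w', (∀ y, y ≠ T → w' y = w y) ∧ w T ≤ w' T ∧ IsModel w' P ∧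
      ∃ u ∈ boundsOn T P, w' T = u.eval w' := by
  rcases (eqTerms T P).eq_empty_or_nonempty with hE | ⟨e, he⟩
  · obtain ⟨u, hu, hmin⟩ :=
      Set.exists_min_image _ (fun e : Aff K D => e.eval w) (finite_boundsOn T hP) hT
    obtain ⟨w', hoff, hx⟩ := exists_eq_off T w (u.eval w)
    have hle : w T ≤ w' T := hx ▸ hw.le_boundsOn hu
    refine ⟨w', hoff, hle, IsModel.of_bounds hoff (fun c hc => hw c hc.1) hE
      (fun l hl => (hw.lowerTerms_le hl).trans hle) (fun b hb => ?_), u, hu, ?_⟩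
    · rw [hx]; exact hmin b (Or.inl hb)
    · rw [hx, Aff.eval_eq_of_eq_off_of_coeff hoff (coeff_boundsOn hu)]
  · exact ⟨w, fun _ _ => rfl, le_rfl, hw, e, Or.inr he, (hw.eval_eqTerms he).symm⟩

/-- If the constraints imply an upper bound on `T`, then they contain one. -/
theorem IsModel.boundsOn_nonempty {P : Set (Constraint K D)} {T : D} {w : D → K}
    (hw : IsModel w P) {u : Aff K D} (hu : Aff.coeff T u = 0)
    (h : ∀ w, IsModel w P → w T ≤ u.eval w) : (boundsOn T P).Nonempty := by
  by_contra hcon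
  rw [Set.not_nonempty_iff_eq_empty] at hcon
  obtain ⟨w', hoff, hx, hw'⟩ := hw.exists_raise_of_unbounded hcon
    ((h w hw).trans (lt_add_one (u.eval w)).le)
  have := h w' hw'
  rw [hx, Aff.eval_eq_of_eq_off_of_coeff hoff hu] at this
  exact (lt_add_one _).not_ge this

/-- Bounds on `T` without the projected dimensions carry over to iterated local projections. -/
theorem LocalProjs.bound {v : D → K} {P P' : Set (Constraint K D)} {ds : List D}
    (h : LocalProjs v P ds P') (hP : P.Finite) {T : D} (hT : T ∉ ds) {u : Aff K D}
    (hds : ∀ d ∈ ds, Aff.coeff d u = 0) (hu : ∀ w, IsModel w P → w T ≤ u.eval w) {w : D → K}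
    (hw : IsModel w P') : w T ≤ u.eval w := by
  obtain ⟨w', hoff, hw'⟩ := h.exists_isModel hP hw
  have := hu w' hw'
  rwa [hoff T hT, Aff.eval_congr fun d hd => hoff d fun hmem => hd (hds d hmem)] at this

/-- The implied bound survives on `P'`, which has the model `v`; were there no explicit bound in
`P'`, `T` could be raised beyond it. -/
theorem LocalProjs.boundsOn_nonempty {v : D → K} {P P' : Set (Constraint K D)} {ds : List D}
    (h : LocalProjs v P ds P') (hP : P.Finite) (hv : IsModel v P) {T : D} (hT : T ∉ ds)
    {u : Aff K D} (huT : Aff.coeff T u = 0) (hds : ∀ d ∈ ds, Aff.coeff d u = 0)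
    (hu : ∀ w, IsModel w P → w T ≤ u.eval w) : (boundsOn T P').Nonempty :=
  (h.isModel hv).boundsOn_nonempty huT fun _ hw => h.bound hP hT hds hu hw

/-- The model from which bounds are conjectured satisfies them. -/
theorem Conjecture.le {v : D → K} {T : D} {P : Set (Constraint K D)} {ds : List D}
    {B : Set (Aff K D)} (h : Conjecture v T P ds B) (hT : (boundsOn T P).Nonempty)
    (hv : IsModel v P) {u : Aff K D} (hu : u ∈ B) : v T ≤ u.eval v := by
  obtain ⟨l₁, l₂, P', -, hP', rfl, -, -⟩ := h.exists_localProjs hT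
  exact (hP'.isModel hv).le_boundsOn hu

/-- Conjectured bounds are at least as low as all implied bounds: they do not contain the dimensions
`l₁`, while every implied bound contains one of the dimensions `l₁` or the next one, if any. -/
theorem Conjecture.optimal {v : D → K} {T : D} {P : Set (Constraint K D)} {ds : List D}
    {B : Set (Aff K D)} (h : Conjecture v T P ds B) (hP : P.Finite)
    (hT : (boundsOn T P).Nonempty) (hTds : T ∉ ds) (hv : IsModel v P) {u : Aff K D} (hu : u ∈ B)
    {b : Aff K D} (hbT : Aff.coeff T b = 0) (hb : ∀ w, IsModel w P → w T ≤ b.eval w) :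
    ∃ l₁ l₂, ds = l₁ ++ l₂ ∧ (∀ d ∈ l₁, Aff.coeff d u = 0) ∧
      ∀ d l, l₂ = d :: l → ∃ y ∈ l₁ ++ [d], Aff.coeff y b ≠ 0 := by
  obtain ⟨l₁, l₂, P', rfl, hP', rfl, -, hl⟩ := h.exists_localProjs hT
  refine ⟨l₁, l₂, rfl, fun d hd => (hP'.isFree (Or.inl hd)).coeff_boundsOn hu, ?_⟩
  rintro d l rfl
  obtain ⟨P'', hP'', hemp⟩ := hl d l rfl
  by_contra! hcon
  have := (hP'.concat hP'').boundsOn_nonempty hP hv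
    (fun hmem => hTds <| by
      simp only [List.mem_append, List.mem_cons] at hmem ⊢; tauto) hbT hcon hb
  exact this.ne_empty hemp

/-! ### Termination of polyhedral reduction -/

/-- Strictness holds because the sample violates every bound in `U` but satisfies those conjectured
from it, of which there is at least one. -/
theorem reduceStep_ssubset {T : D} {P : Set (Constraint K D)} {ds : List D}
    (hT : (boundsOn T P).Nonempty) {U U' : Set (Aff K D)} (h : ReduceStep T P ds U U') :
    U ⊂ U' ∧ U' ⊆ U ∪ conjecturable T P ds := by
  obtain ⟨v, ⟨hv, hU⟩, B, hB, rfl⟩ := h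
  refine ⟨⟨Set.subset_union_left, fun hsub => ?_⟩, Set.union_subset_union_right _ fun u hu =>
    ⟨v, B, hB, hu⟩⟩
  obtain ⟨-, -, -, -, -, -, ⟨u, hu⟩, -⟩ := hB.exists_localProjs hT
  exact hU u (hsub (Or.inr hu)) (hB.le hT hv hu)

theorem terminates_reduceStep {T : D} {P : Set (Constraint K D)} (hP : P.Finite)
    (hT : (boundsOn T P).Nonempty) (ds : List D) {U : Set (Aff K D)} (hU : U.Finite) :
    Terminates (ReduceStep T P ds) U := by
  rintro ⟨s, rfl, hs⟩
  have hmono : StrictMono s := strictMono_nat_of_lt_succ fun n => (reduceStep_ssubset hT (hs n)).1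
  have hsub : ∀ n, s n ⊆ s 0 ∪ conjecturable T P ds := fun n => by
    induction n with
    | zero => exact Set.subset_union_left
    | succ n ih =>
      exact (reduceStep_ssubset hT (hs n)).2.trans (Set.union_subset ih Set.subset_union_right)
  refine Set.infinite_range_of_injective hmono.injective
    ((hU.union (finite_conjecturable T hP ds)).finite_subsets.subset ?_)
  rintro _ ⟨n, rfl⟩
  exact hsub n

end Iterated

/-! ### Exact projections -/

section Exact

variable {K D : Type*} [Field K] [LinearOrder K] [IsStrictOrderedRing K]

/-- Fourier–Motzkin elimination. -/
theorem exists_projection {P : Set (Constraint K D)} (hP : P.Finite) (x : D) :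
    ∃ P' : Set (Constraint K D), P'.Finite ∧ (∀ y, y = x ∨ IsFree y P → IsFree y P') ∧
      (∀ v, IsModel v P → IsModel v P') ∧
      ∀ w, IsModel w P' → ∃ w', (∀ y, y ≠ x → w' y = w y) ∧ IsModel w' P := by
  rcases (eqTerms x P).eq_empty_or_nonempty with hE | ⟨e, he⟩
  · refine ⟨(fun c : Aff K D × Aff K D => Constraint.ge (c.2 - c.1)) ''
      (lowerTerms x P ×ˢ upperTerms x P) ∪ freeConstraints x P, ?_, ?_, ?_, ?_⟩
    · exact (((finite_lowerTerms x hP).prod (finite_upperTerms x hP)).image _).union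
        (hP.subset fun c hc => hc.1)
    · rintro y hy _ (⟨⟨l, u⟩, ⟨hl, hu⟩, rfl⟩ | hc)
      · rw [Constraint.term, Aff.coeff_sub]
        rcases hy with rfl | hy
        · rw [coeff_upperTerms hu, coeff_lowerTerms hl, sub_zero]
        · rw [hy.coeff_upperTerms hu, hy.coeff_lowerTerms hl, sub_zero]
      · rcases hy with rfl | hy
        · exact hc.2
        · exact hy _ hc.1
    · rintro v hv _ (⟨⟨l, u⟩, ⟨hl, hu⟩, rfl⟩ | hc)
      · simpa [Constraint.Holds, Aff.eval_sub] using
          (hv.lowerTerms_le hl).trans (hv.le_upperTerms hu)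
      · exact hv _ hc.1
    · intro w hw
      have hlu : ∀ l ∈ lowerTerms x P, ∀ u ∈ upperTerms x P, l.eval w ≤ u.eval w := by
        intro l hl u hu
        have := hw _ (Or.inl ⟨(l, u), ⟨hl, hu⟩, rfl⟩)
        rwa [Constraint.Holds, Aff.eval_sub, sub_nonneg] at this
      obtain ⟨a, hL, hU⟩ : ∃ a, (∀ l ∈ lowerTerms x P, l.eval w ≤ a) ∧
          ∀ u ∈ upperTerms x P, a ≤ u.eval w := by
        rcases (lowerTerms x P).eq_empty_or_nonempty with hL | hL
        · obtain ⟨a, ha⟩ :=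
            ((finite_upperTerms x hP).image fun u : Aff K D => u.eval w).bddBelow
          exact ⟨a, by simp [hL], fun u hu => ha ⟨u, hu, rfl⟩⟩
        · obtain ⟨l, hl, hmax⟩ :=
            Set.exists_max_image _ (fun e : Aff K D => e.eval w) (finite_lowerTerms x hP) hL
          exact ⟨l.eval w, hmax, hlu l hl⟩
      obtain ⟨w', hoff, rfl⟩ := exists_eq_off x w a
      exact ⟨w', hoff, IsModel.of_bounds hoff (fun c hc => hw c (Or.inr hc)) hE hL hU⟩
  -- Substitution along an equality does not depend on the model, so this local projection is
  -- already exact.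
  · have h : ∀ v, LocalProj v P x (Constraint.subst x e '' P) := fun v => .equality e he
    exact ⟨_, (h 0).finite hP, fun y hy => (h 0).isFree hy, fun v hv => (h v).isModel hv,
      fun w hw => (h w).exists_isModel hP hw⟩

/-- Exact projections are not part of the procedure. They keep every model of `P`, so they are
available before the sample is chosen and serve to find it. -/
theorem exists_projections {P : Set (Constraint K D)} (hP : P.Finite) (ds : List D) :
    ∃ P' : Set (Constraint K D), P'.Finite ∧ (∀ y, y ∈ ds ∨ IsFree y P → IsFree y P') ∧
      (∀ v, IsModel v P → IsModel v P') ∧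
      ∀ w, IsModel w P' → ∃ w', (∀ y, y ∉ ds → w' y = w y) ∧ IsModel w' P := by
  induction ds generalizing P with
  | nil => exact ⟨P, hP, by simp, fun _ => id, fun w hw => ⟨w, fun _ _ => rfl, hw⟩⟩
  | cons d ds ih =>
    obtain ⟨P₁, hP₁, hF₁, hM₁, hE₁⟩ := exists_projection hP d
    obtain ⟨P₂, hP₂, hF₂, hM₂, hE₂⟩ := ih hP₁
    refine ⟨P₂, hP₂, fun y hy => hF₂ y ?_, fun v hv => hM₂ v (hM₁ v hv), fun w hw => ?_⟩
    · rw [List.mem_cons] at hy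
      have := hF₁ y
      tauto
    · obtain ⟨w₂, h₂, hw₂⟩ := hE₂ w hw
      obtain ⟨w₁, h₁, hw₁⟩ := hE₁ w₂ hw₂
      refine ⟨w₁, fun y hy => ?_, hw₁⟩
      rw [List.mem_cons, not_or] at hy
      rw [h₁ y hy.1, h₂ y hy.2]

/-! ### Generic models -/

theorem IsModel.lineMap {P : Set (Constraint K D)} {v w : D → K} (hv : IsModel v P)
    (hw : IsModel w P) {s : K} (hs0 : 0 ≤ s) (hs1 : s ≤ 1) :
    IsModel (fun d => v d + s * (w d - v d)) P := by
  intro c hc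
  have h1 := hv c hc
  have h2 := hw c hc
  cases c with
  | eq c =>
    rw [Constraint.Holds] at *
    rw [Aff.eval_lineMap, h1, h2]; ring
  | ge c =>
    rw [Constraint.Holds] at *
    rw [Aff.eval_lineMap]
    nlinarith [mul_nonneg hs0 h2, mul_nonneg (sub_nonneg.2 hs1) h1]

/-- Close to `v` on a segment from `v`, finitely many affine terms that do not vanish at `v` keep
their signs. -/
theorem exists_pos_sign_lineMap {G : Set (Aff K D)} (hG : G.Finite) {v : D → K}
    (hv : ∀ g ∈ G, g.eval v ≠ 0) (w : D → K) :
    ∃ s : K, 0 < s ∧ s ≤ 1 ∧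
      ∀ g ∈ G, 0 < g.eval v * g.eval (fun d => v d + s * (w d - v d)) := by
  obtain ⟨M, hM⟩ := (hG.image fun g : Aff K D => |g.eval w / g.eval v - 1|).bddAbove
  have hpos : 0 < 1 + |M| := by positivity
  -- `M` bounds the relative change of each `g` over the whole segment; this fraction of the segment
  -- keeps the relative change below `1`.
  refine ⟨(1 + |M|)⁻¹, inv_pos.2 hpos, inv_le_one_of_one_le₀ (by simp), fun g hg => ?_⟩
  have h0 := hv g hg
  have hle : |g.eval w / g.eval v - 1| ≤ |M| := (hM ⟨g, hg, rfl⟩).trans (le_abs_self M)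
  have hlt : (1 + |M|)⁻¹ * |g.eval w / g.eval v - 1| < 1 := by
    rw [inv_mul_lt_iff₀ hpos]; linarith
  have heq : g.eval v * g.eval (fun d => v d + (1 + |M|)⁻¹ * (w d - v d)) =
      g.eval v ^ 2 * (1 + (1 + |M|)⁻¹ * (g.eval w / g.eval v - 1)) := by
    rw [Aff.eval_lineMap]; field_simp
  rw [heq]
  refine mul_pos (by positivity) ?_
  have h1 := neg_abs_le (g.eval w / g.eval v - 1)
  have h2 := mul_le_mul_of_nonneg_left h1 (inv_pos.2 hpos).le
  linarith

/-- Some model avoids the zeros of the affine terms in `F` that do not vanish on the whole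
polyhedron. -/
theorem exists_generic {P : Set (Constraint K D)} {F G : Set (Aff K D)} (hF : F.Finite)
    (hG : G.Finite) {o : D → K} (ho : IsModel o P) (hGo : ∀ g ∈ G, 0 < g.eval o) :
    ∃ w, IsModel w P ∧ (∀ g ∈ G, 0 < g.eval w) ∧
      ∀ f ∈ F, f.eval w = 0 → ∀ z, IsModel z P → f.eval z = 0 := by
  induction F, hF using Set.Finite.induction_on with
  | empty => exact ⟨o, ho, hGo, by simp⟩
  | @insert f F _ hF ih =>
    obtain ⟨w, hw, hGw, hFw⟩ := ih
    by_cases hf : f.eval w = 0 → ∀ z, IsModel z P → f.eval z = 0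
    · refine ⟨w, hw, hGw, fun e he => ?_⟩
      rcases he with rfl | he
      exacts [hf, hFw e he]
    -- If `f` vanishes at `w` but not at `z`, a short move towards `z` makes `f` non-zero and
    -- preserves the signs of everything that was non-zero at `w`.
    · push Not at hf
      obtain ⟨hf0, z, hz, hfz⟩ := hf
      obtain ⟨s, hs0, hs1, hs⟩ := exists_pos_sign_lineMap
        (hG.union (hF.subset (Set.sep_subset F fun e => e.eval w ≠ 0))) (v := w)
        (fun g hg => hg.elim (fun hg => (hGw g hg).ne') fun hg => hg.2) z
      refine ⟨_, hw.lineMap hz hs0.le hs1, fun g hg => ?_, fun e he he0 => ?_⟩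
      · exact pos_of_mul_pos_right (hs g (Or.inl hg)) (hGw g hg).le
      · rcases he with rfl | he
        · rw [Aff.eval_lineMap, hf0, zero_add, sub_zero, mul_eq_zero] at he0
          exact (he0.elim hs0.ne' hfz).elim
        · by_cases hew : e.eval w = 0
          · exact hFw e he hew
          · have := hs e (Or.inr ⟨he, hew⟩)
            rw [he0, mul_zero] at this
            exact (lt_irrefl _ this).elim

/-! ### Conjecturing a valid bound -/

theorem exists_maximal_prefix {α : Type*} {p : List α → Prop} (hp : p []) (l : List α) :
    ∃ l₁ l₂, l = l₁ ++ l₂ ∧ p l₁ ∧ ∀ a l', l₂ = a :: l' → ¬ p (l₁ ++ [a]) := by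
  suffices ∀ l₂ l₁, p l₁ → ∃ k₁ k₂, l₁ ++ l₂ = k₁ ++ k₂ ∧ p k₁ ∧
      ∀ a l', k₂ = a :: l' → ¬ p (k₁ ++ [a]) from this l [] hp
  intro l₂
  induction l₂ with
  | nil => exact fun l₁ h => ⟨l₁, [], rfl, h, by simp⟩
  | cons a l₂ ih =>
    intro l₁ h
    by_cases ha : p (l₁ ++ [a])
    · obtain ⟨k₁, k₂, hk, h'⟩ := ih _ ha
      exact ⟨k₁, k₂, by simpa using hk, h'⟩
    · refine ⟨l₁, a :: l₂, rfl, h, fun b l' hb => ?_⟩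
      obtain ⟨rfl, rfl⟩ := List.cons.inj hb
      exact ha

/-- If all implied bounds on `T` contain one of the dimensions `ds`, then `T` can exceed any finite
set of terms without these dimensions. -/
theorem exists_isModel_gt {P : Set (Constraint K D)} (hP : P.Finite) {T : D} {ds : List D}
    (hT : T ∉ ds) {p : D → K} (hp : IsModel p P)
    (hunb : ¬ ∃ u, Aff.coeff T u = 0 ∧ (∀ d ∈ ds, Aff.coeff d u = 0) ∧
      ∀ w, IsModel w P → w T ≤ u.eval w) {Φ : Set (Aff K D)} (hΦ : Φ.Finite)
    (hΦT : ∀ u ∈ Φ, Aff.coeff T u = 0) (hΦds : ∀ u ∈ Φ, ∀ d ∈ ds, Aff.coeff d u = 0) :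
    ∃ o, IsModel o P ∧ ∀ u ∈ Φ, u.eval o < o T := by
  obtain ⟨Q, -, hQF, hQM, hQE⟩ := exists_projections hP ds
  have hemp : boundsOn T Q = ∅ := by
    rw [Set.eq_empty_iff_forall_notMem]
    exact fun u hu => hunb ⟨u, coeff_boundsOn hu, fun d hd =>
      (hQF d (Or.inl hd)).coeff_boundsOn hu, fun w hw => (hQM w hw).le_boundsOn hu⟩
  obtain ⟨M, hM⟩ := (hΦ.image fun u : Aff K D => u.eval p).bddAbove
  obtain ⟨w, hoff, hwT, hw⟩ := (hQM p hp).exists_raise_of_unbounded hemp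
    (le_max_left (p T) (M + 1))
  obtain ⟨o, hoff', ho⟩ := hQE w hw
  refine ⟨o, ho, fun u hu => ?_⟩
  -- The passage from `p` to `o` changes only `T` and `ds`, which the terms in `Φ` do not contain,
  -- so these keep their values at `p`.
  rw [hoff' T hT, hwT, Aff.eval_congr fun d hd => hoff' d fun hmem => hd (hΦds u hu d hmem),
    Aff.eval_eq_of_eq_off_of_coeff hoff (hΦT u hu)]
  exact ((hM ⟨u, hu, rfl⟩).trans_lt (lt_add_one M)).trans_le (le_max_right _ _)

/-- From some model of a non-empty polyhedron, a valid bound is conjectured. -/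
theorem exists_conjecture_valid {P : Set (Constraint K D)} (hP : P.Finite) {T : D} {ds : List D}
    (hT : T ∉ ds) (hbd : (boundsOn T P).Nonempty) {p : D → K} (hp : IsModel p P) :
    ∃ v B, IsModel v P ∧ Conjecture v T P ds B ∧ ∃ u ∈ B, ∀ w, IsModel w P → w T ≤ u.eval w := by
  let valid : List D → Prop := fun l => ∃ u : Aff K D, Aff.coeff T u = 0 ∧
    (∀ d ∈ l, Aff.coeff d u = 0) ∧ ∀ w, IsModel w P → w T ≤ u.eval w
  obtain ⟨l₁, l₂, rfl, ⟨u₀, hu₀T, hu₀l, hu₀⟩, hmax⟩ := exists_maximal_prefix (p := valid)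
    (by
      obtain ⟨u, hu⟩ := hbd
      exact ⟨u, coeff_boundsOn hu, by simp, fun w hw => hw.le_boundsOn hu⟩) ds
  have hTl₁ : T ∉ l₁ := fun h => hT (List.mem_append_left _ h)
  have hΦfin := finite_conjecturable T hP (l₁ ++ l₂)
  have hΦT : ∀ u ∈ conjecturable T P (l₁ ++ l₂), Aff.coeff T u = 0 :=
    fun u ⟨v, B, h, hu⟩ => h.isFree hbd hu (Or.inl rfl)
  -- the conjecturable bounds that arise after projecting more dimensions than `l₁`
  let Φ : Set (Aff K D) := {u ∈ conjecturable T P (l₁ ++ l₂) |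
    ∃ d l, l₂ = d :: l ∧ ∀ y ∈ l₁ ++ [d], Aff.coeff y u = 0}
  have hΦ : Φ.Finite := hΦfin.subset (Set.sep_subset _ _)
  obtain ⟨o, ho, hoΦ⟩ : ∃ o, IsModel o P ∧ ∀ u ∈ Φ, u.eval o < o T := by
    cases l₂ with
    | nil =>
      refine ⟨p, hp, ?_⟩
      rintro u ⟨-, d, l, hl, -⟩
      cases hl
    | cons d l =>
      refine exists_isModel_gt hP (ds := l₁ ++ [d]) (fun hmem => hT ?_) hp (hmax d l rfl) hΦ
        (fun u hu => hΦT u hu.1) ?_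
      · simp only [List.mem_append, List.mem_cons] at hmem ⊢; tauto
      · rintro u ⟨-, d', l', hl, hu⟩
        obtain ⟨rfl, rfl⟩ := List.cons.inj hl
        exact hu
  obtain ⟨Q, hQfin, hQF, hQM, hQE⟩ := exists_projections hP l₁
  have hQbd : (boundsOn T Q).Nonempty := (hQM p hp).boundsOn_nonempty hu₀T fun w hw => by
    obtain ⟨w', hoff, hw'⟩ := hQE w hw
    have := hu₀ w' hw'
    rwa [hoff T hTl₁, Aff.eval_congr fun d hd => hoff d fun hmem => hd (hu₀l d hmem)] at this
  -- `G` keeps `T` above the bounds in `Φ`. `F` forces a conjecturable bound and a bound of `Q` that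
  -- agree at `w` to agree on all of `P`.
  obtain ⟨w, hw, hGw, hFw⟩ := exists_generic
    (F := Set.image2 (fun u u' => u - u') (conjecturable T P (l₁ ++ l₂)) (boundsOn T Q))
    (G := (fun u => Aff.dim T - u) '' Φ) (hΦfin.image2 _ (finite_boundsOn T hQfin))
    (hΦ.image _) ho (by
      rintro _ ⟨u, hu, rfl⟩
      rw [Aff.eval_sub, Aff.eval_dim]
      exact sub_pos.2 (hoΦ u hu))
  -- Raising `T` to a tight bound `u'` of `Q` and lifting back to `P` changes only `T` and `l₁`;
  -- terms without these have the same value at the sample `v` as at `w`.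
  obtain ⟨w₁, hoff₁, hle₁, hw₁, u', hu', htight⟩ := (hQM w hw).exists_raise hQfin hQbd
  obtain ⟨v, hoffv, hv⟩ := hQE w₁ hw₁
  have hvw : ∀ e : Aff K D, Aff.coeff T e = 0 → (∀ d ∈ l₁, Aff.coeff d e = 0) →
      e.eval v = e.eval w := fun e heT hel => by
    rw [Aff.eval_congr fun d hd => hoffv d fun hmem => hd (hel d hmem),
      Aff.eval_eq_of_eq_off_of_coeff hoff₁ heT]
  have hu'T : Aff.coeff T u' = 0 := coeff_boundsOn hu'
  have hu'l : ∀ d ∈ l₁, Aff.coeff d u' = 0 := fun d hd => (hQF d (Or.inl hd)).coeff_boundsOn hu'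
  have hvT : v T = u'.eval v := by
    rw [hoffv T hTl₁, htight,
      Aff.eval_congr fun d hd => hoffv d fun hmem => hd (hu'l d hmem)]
  obtain ⟨B, hB⟩ := exists_conjecture v T hP (l₁ ++ l₂)
  refine ⟨v, B, hv, hB, ?_⟩
  obtain ⟨k₁, k₂, P', hk, hP', hBeq, ⟨b, hb⟩, hlast⟩ := hB.exists_localProjs hbd
  have hk₁ : k₁ = l₁ := by
    -- Projecting beyond `l₁` would give a bound in `Φ`, which lies below `T` at `v`, although `v`
    -- satisfies its conjectured bounds. Stopping earlier is impossible because the implied bound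
    -- `u₀` survives the next projection.
    rcases List.append_eq_append_iff.1 hk with ⟨a, rfl, ha⟩ | ⟨a, rfl, ha⟩
    · cases a with
      | nil => simp
      | cons d a =>
        have hbl : ∀ y ∈ l₁ ++ d :: a, Aff.coeff y b = 0 := fun y hy =>
          (hP'.isFree (Or.inl hy)).coeff_boundsOn (hBeq ▸ hb)
        have hbΦ : b ∈ Φ := ⟨⟨v, B, hB, hb⟩, d, a ++ k₂, ha, fun y hy => hbl y <| by
          simp only [List.mem_append, List.mem_cons] at hy ⊢; tauto⟩
        have h1 := hGw _ ⟨b, hbΦ, rfl⟩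
        rw [Aff.eval_sub, Aff.eval_dim, sub_pos, ← hvw b (hΦT b hbΦ.1) fun y hy =>
          hbl y (List.mem_append_left _ hy)] at h1
        have h2 := hB.le hbd hv hb
        rw [hoffv T hTl₁] at h2
        exact absurd (h1.trans_le hle₁) h2.not_gt
    · cases a with
      | nil => simp
      | cons d a =>
        obtain ⟨P'', hP'', hemp⟩ := hlast d _ ha
        refine absurd hemp ((hP'.concat hP'').boundsOn_nonempty hP hv (fun hmem => hTl₁ ?_) hu₀T
          (fun y hy => hu₀l y ?_) hu₀).ne_empty
        · simp only [List.mem_append, List.mem_cons] at hmem ⊢; tauto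
        · simp only [List.mem_append, List.mem_cons] at hy ⊢; tauto
  subst hk₁
  obtain ⟨w₂, hoff₂, hle₂, hw₂, u, hu, htight₂⟩ :=
    (hP'.isModel hv).exists_raise (hP'.finite hP) ⟨b, hBeq.subset hb⟩
  have huT : Aff.coeff T u = 0 := coeff_boundsOn hu
  have hul : ∀ d ∈ k₁, Aff.coeff d u = 0 := fun d hd =>
    (hP'.isFree (Or.inl hd)).coeff_boundsOn hu
  obtain ⟨w₃, hoff₃, hw₃⟩ := hP'.exists_isModel hP hw₂
  have h3 := (hQM w₃ hw₃).le_boundsOn hu'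
  rw [hoff₃ T hTl₁, Aff.eval_congr fun d hd => hoff₃ d fun hmem => hd (hu'l d hmem),
    Aff.eval_eq_of_eq_off_of_coeff hoff₂ hu'T, ← hvT] at h3
  have huv : u.eval v = u'.eval v := by
    rw [← hvT, ← Aff.eval_eq_of_eq_off_of_coeff hoff₂ huT, ← htight₂]
    exact le_antisymm h3 hle₂
  refine ⟨u, hBeq ▸ hu, fun z hz => ?_⟩
  have hzero := hFw (u - u') ⟨u, ⟨v, B, hB, hBeq ▸ hu⟩, u', hu', rfl⟩ (by
    rw [Aff.eval_sub, ← hvw u huT hul, ← hvw u' hu'T hu'l, huv, sub_self]) z hz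
  rw [Aff.eval_sub, sub_eq_zero] at hzero
  rw [hzero]
  exact (hQM z hz).le_boundsOn hu'

/-- Some complete run of polyhedral reduction by a non-empty polyhedron has a result. -/
theorem exists_polyReduce {P : Set (Constraint K D)} (hP : P.Finite) {T : D} {t : Aff K D}
    {ds : List D} (hT : T ∉ ds) (hbd : (boundsOn T (withTarget T P t)).Nonempty) {p : D → K}
    (hp : IsModel p (withTarget T P t)) : ∃ u, PolyReduce T P t ds u := by
  have hP' : (withTarget T P t).Finite := hP.union (Set.finite_singleton _)
  obtain ⟨v, B, hv, hB, u, hu, huv⟩ := exists_conjecture_valid hP' hT hbd hp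
  -- While there are no bounds, every model is a sample, so the run may start with `v`; the valid
  -- bound then stays in the growing set.
  have hstep : ReduceStep T (withTarget T P t) ds ∅ B := ⟨v, ⟨hv, by simp⟩, B, hB, by simp⟩
  have hBfin : B.Finite := (finite_conjecturable T hP' ds).subset fun u hu => ⟨v, B, hB, hu⟩
  obtain ⟨U, hU, hnormal⟩ := (terminates_reduceStep hP' hbd ds hBfin).exists_normal
  refine ⟨u, U, .head hstep hU, ?_, ?_, huv⟩
  · rwa [reduceStep_iff_exists_isSample hP'] at hnormal
  · clear hnormal
    induction hU with
    | refl => exact hu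
    | tail _ h ih => exact (reduceStep_ssubset hbd h).1.1 ih

end Exact

/-! ### Gröbner bases and multivariate division -/

section Groebner

variable {K σ : Type*} [Field K] {m : MonomialOrder σ}

/-- By Hilbert's basis theorem, finitely many of the leading terms already generate the ideal of all
leading terms. -/
theorem exists_isGroebnerBasis [Finite σ] (m : MonomialOrder σ) (I : Ideal (MvPolynomial σ K)) :
    ∃ B, IsGroebnerBasis m B I := by
  classical
  obtain ⟨S, hS, hspan⟩ := (Submodule.fg_span_iff_fg_span_finset_subset
    (R := MvPolynomial σ K) (m.leadingTerm '' (I : Set (MvPolynomial σ K)))).1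
    (IsNoetherian.noetherian _)
  obtain ⟨B, hB, rfl⟩ := Finset.subset_set_image_iff.1 hS
  exact ⟨B, hB, by rw [Ideal.span, Ideal.span, hspan, Finset.coe_image]⟩

/-- No monomial of `f` is divisible by the leading monomial of a non-zero element of `B`. -/
def IsNormal (m : MonomialOrder σ) (B : Finset (MvPolynomial σ K)) (f : MvPolynomial σ K) : Prop :=
  ∀ μ ∈ f.support, ∀ g ∈ B, g ≠ 0 → ¬ m.degree g ≤ μ

theorem IsNormal.add {B : Finset (MvPolynomial σ K)} {f g : MvPolynomial σ K}
    (hf : IsNormal m B f) (hg : IsNormal m B g) : IsNormal m B (f + g) := by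
  classical
  intro μ hμ
  exact (Finset.mem_union.1 (MvPolynomial.support_add hμ)).elim (hf μ) (hg μ)

theorem IsNormal.smul {B : Finset (MvPolynomial σ K)} {f : MvPolynomial σ K}
    (hf : IsNormal m B f) (c : K) : IsNormal m B (c • f) :=
  fun μ hμ => hf μ (MvPolynomial.support_smul hμ)

theorem IsNormal.sub {B : Finset (MvPolynomial σ K)} {f g : MvPolynomial σ K}
    (hf : IsNormal m B f) (hg : IsNormal m B g) : IsNormal m B (f - g) := by
  simpa [sub_eq_add_neg] using hf.add (hg.smul (-1))

theorem IsNormal.zero {B : Finset (MvPolynomial σ K)} :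
    IsNormal m B (0 : MvPolynomial σ K) := by
  simp [IsNormal]

theorem IsNormal.sum {B : Finset (MvPolynomial σ K)} {ι : Type*} (s : Finset ι)
    {f : ι → MvPolynomial σ K} (hf : ∀ i ∈ s, IsNormal m B (f i)) :
    IsNormal m B (∑ i ∈ s, f i) :=
  Finset.sum_induction f (IsNormal m B) (fun _ _ => IsNormal.add) IsNormal.zero hf

/-- The leading term of a non-zero `f` would lie in a monomial ideal, hence be divisible by the
leading monomial of some element of `B`. Applied to differences, this is uniqueness of remainders.
-/
theorem IsGroebnerBasis.eq_zero {B : Finset (MvPolynomial σ K)} {I : Ideal (MvPolynomial σ K)}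
    (hB : IsGroebnerBasis m B I) {f : MvPolynomial σ K} (hf : f ∈ I) (hn : IsNormal m B f) :
    f = 0 := by
  by_contra h0
  have hlt : m.leadingTerm f ∈ Ideal.span
      ((fun s => MvPolynomial.monomial s (1 : K)) '' {d | ∃ g ∈ B, g ≠ 0 ∧ d = m.degree g}) := by
    have : m.leadingTerm f ∈ Ideal.span (m.leadingTerm '' (B : Set (MvPolynomial σ K))) :=
      hB.2 ▸ Ideal.subset_span ⟨f, hf, rfl⟩
    refine Ideal.span_le.2 ?_ this
    rintro _ ⟨g, hg, rfl⟩
    rcases eq_or_ne g 0 with rfl | hg0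
    · simp
    · have : m.leadingTerm g =
          MvPolynomial.C (m.leadingCoeff g) * MvPolynomial.monomial (m.degree g) 1 := by
        rw [MvPolynomial.C_mul_monomial, mul_one]; rfl
      rw [this]
      exact Ideal.mul_mem_left _ _ (Ideal.subset_span ⟨_, ⟨g, hg, hg0, rfl⟩, rfl⟩)
  obtain ⟨_, ⟨g, hg, hg0, rfl⟩, hle⟩ := MvPolynomial.mem_ideal_span_monomial_image.1 hlt
    (m.degree f) (by rw [m.support_leadingTerm' h0]; simp)
  exact hn _ (m.degree_mem_support h0) g hg hg0 hle

/-- The extra bottom value separates `0` from the non-zero constants, so that the last division step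
also counts as a decrease. -/
theorem withBotDegree_lt_of_coeff {f h : MvPolynomial σ K} (hf : f ≠ 0)
    (hle : m.degree h ≼[m] m.degree f) (hc : h.coeff (m.degree f) = 0) :
    m.withBotDegree h ≺'[m] m.withBotDegree f := by
  refine (MonomialOrder.withBotDegree_lt_withBotDegree_iff ..).2 ?_
  by_cases h0 : h = 0
  · exact Or.inr ⟨h0, hf⟩
  refine Or.inl (lt_of_le_of_ne hle fun heq => ?_)
  rw [← m.toSyn.injective heq] at hc
  exact h0 (m.coeff_degree_eq_zero_iff.1 hc)

theorem degree_divStep_le {f g : MvPolynomial σ K} (hdvd : m.degree g ≤ m.degree f) :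
    m.degree (f - MvPolynomial.monomial (m.degree f - m.degree g)
      (m.leadingCoeff f / m.leadingCoeff g) * g) ≼[m] m.degree f := by
  refine m.degree_sub_le.trans (sup_le le_rfl (m.degree_mul_le.trans ?_))
  rw [map_add]
  refine (add_le_add_left (m.degree_monomial_le _) _).trans ?_
  rw [← map_add, tsub_add_cancel_of_le hdvd]

theorem DivStep.withBotDegree_lt {B : Finset (MvPolynomial σ K)}
    {a b : MvPolynomial σ K × MvPolynomial σ K} (h : DivStep m B a b) :
    m.withBotDegree b.1 ≺'[m] m.withBotDegree a.1 := by
  cases h with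
  | divide f s g hf hg hg0 hdvd =>
    refine withBotDegree_lt_of_coeff hf (degree_divStep_le hdvd) ?_
    have : m.degree f = (m.degree f - m.degree g) + m.degree g :=
      (tsub_add_cancel_of_le hdvd).symm
    rw [MvPolynomial.coeff_sub]
    nth_rw 2 [this]
    rw [MvPolynomial.coeff_monomial_mul, sub_eq_zero]
    exact (div_mul_cancel₀ _ (m.leadingCoeff_ne_zero_iff.2 hg0)).symm
  | remainder f s hf hndvd =>
    refine withBotDegree_lt_of_coeff hf (m.degree_sub_leadingTerm_le f) ?_
    classical
    rw [MvPolynomial.coeff_sub, MonomialOrder.leadingTerm, MvPolynomial.coeff_monomial, if_pos rfl]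
    exact sub_self _

theorem terminates_divStep (m : MonomialOrder σ) (B : Finset (MvPolynomial σ K))
    (a : MvPolynomial σ K × MvPolynomial σ K) : Terminates (DivStep m B) a :=
  terminates_of_wellFounded (InvImage.wf
    (fun a : MvPolynomial σ K × MvPolynomial σ K => m.toWithBotSyn (m.withBotDegree a.1))
    wellFounded_lt) (fun _ _ h => h.withBotDegree_lt) a

theorem exists_isRed (m : MonomialOrder σ) (B : Finset (MvPolynomial σ K))
    (f : MvPolynomial σ K) : ∃ f', IsRed m B f f' := by
  obtain ⟨⟨g, s⟩, h, hnormal⟩ := (terminates_divStep m B (f, 0)).exists_normal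
  rcases eq_or_ne g 0 with rfl | hg
  · exact ⟨s, h⟩
  · refine (hnormal ?_).elim
    by_cases hd : ∃ b ∈ B, b ≠ 0 ∧ m.degree b ≤ m.degree g
    · obtain ⟨b, hb, hb0, hd⟩ := hd
      exact ⟨_, .divide g s b hg hb hb0 hd⟩
    · push Not at hd
      exact ⟨_, .remainder g s hg hd⟩

theorem isRed_invariant {B : Finset (MvPolynomial σ K)} {I : Ideal (MvPolynomial σ K)}
    (hB : (B : Set (MvPolynomial σ K)) ⊆ I) {f : MvPolynomial σ K}
    {a : MvPolynomial σ K × MvPolynomial σ K}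
    (h : Relation.ReflTransGen (DivStep m B) (f, 0) a) :
    f - (a.1 + a.2) ∈ I ∧ m.degree a.1 ≼[m] m.degree f ∧ m.degree a.2 ≼[m] m.degree f ∧
      IsNormal m B a.2 := by
  induction h with
  | refl => simp [IsNormal.zero]
  | tail _ h ih =>
    obtain ⟨hI, h1, h2, hn⟩ := ih
    cases h with
    | divide g s b hg hb hb0 hdvd =>
      refine ⟨?_, (degree_divStep_le hdvd).trans h1, h2, hn⟩
      have := I.add_mem hI (I.mul_mem_left (MvPolynomial.monomial (m.degree g - m.degree b)
        (m.leadingCoeff g / m.leadingCoeff b)) (hB hb))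
      convert this using 1
      ring
    | remainder g s hg hndvd =>
      refine ⟨?_, (m.degree_sub_leadingTerm_le g).trans h1,
        m.degree_add_le.trans (sup_le h2 ?_), hn.add fun μ hμ => ?_⟩
      · convert hI using 1
        ring
      · rwa [m.degree_leadingTerm]
      · rw [m.support_leadingTerm' hg, Finset.mem_singleton] at hμ
        exact hμ ▸ hndvd

theorem IsRed.sub_mem {B : Finset (MvPolynomial σ K)} {I : Ideal (MvPolynomial σ K)}
    (hB : IsGroebnerBasis m B I) {f f' : MvPolynomial σ K} (h : IsRed m B f f') : f - f' ∈ I := by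
  simpa using (isRed_invariant hB.1 h).1

theorem IsRed.isNormal {B : Finset (MvPolynomial σ K)} {I : Ideal (MvPolynomial σ K)}
    (hB : IsGroebnerBasis m B I) {f f' : MvPolynomial σ K} (h : IsRed m B f f') :
    IsNormal m B f' :=
  (isRed_invariant hB.1 h).2.2.2

theorem IsRed.degree_le {B : Finset (MvPolynomial σ K)} {I : Ideal (MvPolynomial σ K)}
    (hB : IsGroebnerBasis m B I) {f f' : MvPolynomial σ K} (h : IsRed m B f f') :
    m.degree f' ≼[m] m.degree f :=
  (isRed_invariant hB.1 h).2.2.1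

/-- A constant is its own remainder, unless the ideal is everything. -/
theorem IsGroebnerBasis.isNormal_one {B : Finset (MvPolynomial σ K)}
    {I : Ideal (MvPolynomial σ K)} (hB : IsGroebnerBasis m B I) (hI : (1 : MvPolynomial σ K) ∉ I) :
    IsNormal m B (1 : MvPolynomial σ K) := by
  classical
  intro μ hμ g hg hg0 hle
  have hμ0 : μ = 0 := by
    simpa [MvPolynomial.mem_support_iff, MvPolynomial.coeff_one, eq_comm] using hμ
  rw [hμ0, nonpos_iff_eq_zero] at hle
  refine hI ((Ideal.eq_top_iff_one I).1 (Ideal.eq_top_of_isUnit_mem I (hB.1 hg) ?_))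
  rw [m.degree_eq_zero_iff.1 hle]
  exact (m.leadingCoeff_ne_zero_iff.2 hg0).isUnit.map MvPolynomial.C

end Groebner

/-! ### Polynomials as affine terms -/

section Terms

variable {K σ : Type*} [Field K]

theorem coeff_none_toAff (f : MvPolynomial σ K) : Aff.coeff none (toAff f) = 0 := by
  simp [Aff.coeff, toAff, Finsupp.finsetSum_apply]

theorem coeff_some_zero_toAff (f : MvPolynomial σ K) : Aff.coeff (some 0) (toAff f) = 0 := by
  classical
  simp only [Aff.coeff, toAff, Finsupp.finsetSum_apply]
  refine Finset.sum_eq_zero fun μ hμ => ?_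
  rw [Finsupp.single_apply, if_neg]
  simpa using (Finset.mem_erase.1 hμ).1

theorem coeff_some_toAff (f : MvPolynomial σ K) {μ : σ →₀ ℕ} (hμ : μ ≠ 0) :
    Aff.coeff (some μ) (toAff f) = f.coeff μ := by
  classical
  simp only [Aff.coeff, toAff, Finsupp.finsetSum_apply, Finsupp.single_apply, Option.some.injEq]
  rw [Finset.sum_ite_eq']
  split_ifs with h
  · rfl
  · rw [Finset.mem_erase, not_and] at h
    exact (MvPolynomial.notMem_support_iff.1 (h hμ)).symm

open Classical in
theorem coeff_ofAff (e : Aff K (Dim σ)) (μ : σ →₀ ℕ) :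
    (ofAff e).coeff μ = Aff.coeff (some μ) e + if μ = 0 then e.2 else 0 := by
  have key : ∀ l : Dim σ →₀ K,
      (l.sum fun d a => d.elim 0 fun μ => MvPolynomial.monomial μ a).coeff μ = l (some μ) := by
    intro l
    induction l using Finsupp.induction_linear with
    | zero => simp
    | add f g hf hg =>
      rw [Finsupp.sum_add_index', MvPolynomial.coeff_add, hf, hg, Finsupp.add_apply]
      · rintro (_ | ν) <;> simp
      · rintro (_ | ν) a b <;> simp
    | single d a =>
      rcases d with _ | ν
      · simp
      · rw [Finsupp.sum_single_index (by simp)]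
        simp [MvPolynomial.coeff_monomial, Finsupp.single_apply]
  rw [ofAff, MvPolynomial.coeff_add, key, MvPolynomial.coeff_C]
  simp [Aff.coeff, eq_comm]

theorem ofAff_toAff (f : MvPolynomial σ K) : ofAff (toAff f) = f := by
  ext μ
  rw [coeff_ofAff]
  rcases eq_or_ne μ 0 with rfl | hμ
  · rw [coeff_some_zero_toAff, zero_add, if_pos rfl]; rfl
  · simp [coeff_some_toAff f hμ, hμ]

theorem aff_ext {D : Type*} {e f : Aff K D} (h : ∀ d, Aff.coeff d e = Aff.coeff d f)
    (h' : e.2 = f.2) : e = f :=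
  Prod.ext (Finsupp.ext h) h'

/-- `ofAff` as a linear map. -/
noncomputable def ofAffₗ : Aff K (Dim σ) →ₗ[K] MvPolynomial σ K where
  toFun := ofAff
  map_add' e f := by
    ext μ
    simp only [coeff_ofAff, MvPolynomial.coeff_add, Aff.coeff_add, Prod.snd_add]
    split_ifs <;> ring
  map_smul' a e := by
    ext μ
    simp only [coeff_ofAff, MvPolynomial.coeff_smul, Aff.coeff_smul, Prod.smul_snd, smul_eq_mul,
      RingHom.id_apply]
    split_ifs <;> ring

/-- `toAff` as a linear map. -/
noncomputable def toAffₗ : MvPolynomial σ K →ₗ[K] Aff K (Dim σ) where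
  toFun := toAff
  map_add' f g := by
    refine aff_ext (fun d => ?_) (by simp [toAff])
    rcases d with _ | μ
    · simp [Aff.coeff_add, coeff_none_toAff]
    · rcases eq_or_ne μ 0 with rfl | hμ
      · simp [Aff.coeff_add, coeff_some_zero_toAff]
      · simp [Aff.coeff_add, coeff_some_toAff _ hμ]
  map_smul' a f := by
    refine aff_ext (fun d => ?_) (by simp [toAff])
    rcases d with _ | μ
    · simp [Aff.coeff_smul, coeff_none_toAff]
    · rcases eq_or_ne μ 0 with rfl | hμ
      · simp [Aff.coeff_smul, coeff_some_zero_toAff]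
      · simp [Aff.coeff_smul, coeff_some_toAff _ hμ]

theorem ofAff_const (a : K) : ofAff ((0, a) : Aff K (Dim σ)) = MvPolynomial.C a := by
  simp [ofAff]

theorem toAff_one : toAff (1 : MvPolynomial σ K) = (0, 1) := by
  classical
  refine aff_ext (fun d => ?_) (by simp [toAff])
  change _ = (0 : K)
  rcases d with _ | μ
  · exact coeff_none_toAff _
  · rcases eq_or_ne μ 0 with rfl | hμ
    · exact coeff_some_zero_toAff _
    · rw [coeff_some_toAff _ hμ, MvPolynomial.coeff_one, if_neg hμ.symm]

end Terms

/-! ### Cones -/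

section Cones

theorem map_mem_polyhedralCone {K V W : Type*} [Field K] [LinearOrder K] [AddCommGroup V]
    [Module K V] [AddCommGroup W] [Module K W] (φ : V →ₗ[K] W) {n : ℕ} {v : Fin n → V} {x y : V}
    (hx : x ∈ polyhedralCone K (Fin.snoc v y : Fin (n + 1) → V)) :
    φ x ∈ polyhedralCone K (Fin.snoc (fun i => φ (v i)) (φ y) : Fin (n + 1) → W) := by
  obtain ⟨c, hc, rfl⟩ := hx
  exact ⟨c, hc, by simp [Fin.sum_univ_castSucc]⟩

variable {K σ : Type*} [Field K] [LinearOrder K] {k r : ℕ}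

/-- The easy direction of Farkas' lemma, by linearity of evaluation. -/
theorem Aff.eval_nonneg_of_mem_cone [IsStrictOrderedRing K] {D : Type*} {n : ℕ}
    {S : Fin n → Aff K D} {f : Aff K D}
    (hf : f ∈ polyhedralCone K (Fin.snoc S (0, 1) : Fin (n + 1) → Aff K D)) {w : D → K}
    (hw : ∀ i, 0 ≤ (S i).eval w) : 0 ≤ f.eval w := by
  let φ : Aff K D →ₗ[K] K :=
    { toFun := fun e => e.eval w
      map_add' := fun e f => Aff.eval_add e f w
      map_smul' := fun a e => Aff.eval_smul a e w }
  obtain ⟨c, hc, h⟩ := map_mem_polyhedralCone φ hf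
  change f.eval w = _ at h
  rw [h, Fin.sum_univ_castSucc]
  refine add_nonneg (Finset.sum_nonneg fun i _ => ?_) ?_
  · simpa [φ] using mul_nonneg (hc _) (hw i)
  · simpa [φ, Aff.eval] using hc (Fin.last n)

theorem toAff_mem_cone {q : Fin r → MvPolynomial σ K} {f : MvPolynomial σ K}
    (hf : f ∈ polyhedralCone K (Fin.snoc q 1 : Fin (r + 1) → MvPolynomial σ K)) :
    toAff f ∈ polyhedralCone K
      (Fin.snoc (fun i => toAff (q i)) (0, 1) : Fin (r + 1) → Aff K (Dim σ)) := by
  have := map_mem_polyhedralCone toAffₗ hf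
  change toAff f ∈ polyhedralCone K (Fin.snoc (fun i => toAff (q i)) (toAff 1)) at this
  rwa [toAff_one] at this

theorem ofAff_mem_cone {q : Fin r → MvPolynomial σ K} {e : Aff K (Dim σ)}
    (he : e ∈ polyhedralCone K
      (Fin.snoc (fun i => toAff (q i)) (0, 1) : Fin (r + 1) → Aff K (Dim σ))) :
    ofAff e ∈ polyhedralCone K (Fin.snoc q 1 : Fin (r + 1) → MvPolynomial σ K) := by
  have := map_mem_polyhedralCone ofAffₗ he
  change ofAff e ∈ polyhedralCone K
    (Fin.snoc (fun i => ofAff (toAff (q i))) (ofAff (0, 1))) at this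
  simpa only [ofAff_toAff, ofAff_const, MvPolynomial.C_1] using this

theorem mem_coneOf_of_sub_mem {p : Fin k → MvPolynomial σ K} {q : Fin r → MvPolynomial σ K}
    {f g : MvPolynomial σ K} (h : f - g ∈ Ideal.span (Set.range p)) (hg : g ∈ coneOf p q) :
    f ∈ coneOf p q := by
  obtain ⟨a, ha, b, hb, rfl⟩ := hg
  exact ⟨_, Ideal.add_mem _ h ha, b, hb, by ring⟩

omit [LinearOrder K] in
theorem sum_snoc_sub_mem {I : Ideal (MvPolynomial σ K)} {q q' : Fin r → MvPolynomial σ K}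
    (h : ∀ i, q i - q' i ∈ I) (y : MvPolynomial σ K) (c : Fin (r + 1) → K) :
    ∑ i, c i • (Fin.snoc q y : Fin (r + 1) → MvPolynomial σ K) i -
      ∑ i, c i • (Fin.snoc q' y : Fin (r + 1) → MvPolynomial σ K) i ∈ I := by
  rw [← Finset.sum_sub_distrib]
  refine I.sum_mem fun i _ => ?_
  rw [← smul_sub]
  refine Submodule.smul_of_tower_mem I _ ?_
  induction i using Fin.lastCases with
  | last => simp
  | cast i => simpa using h i

theorem mem_coneOf_of_mem_cone {p : Fin k → MvPolynomial σ K} {q q' : Fin r → MvPolynomial σ K}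
    (h : ∀ i, q i - q' i ∈ Ideal.span (Set.range p)) {f : MvPolynomial σ K}
    (hf : f ∈ polyhedralCone K (Fin.snoc q' 1 : Fin (r + 1) → MvPolynomial σ K)) :
    f ∈ coneOf p q := by
  obtain ⟨c, hc, rfl⟩ := hf
  exact ⟨_, Submodule.neg_mem _ (sum_snoc_sub_mem h 1 c), _, ⟨c, hc, rfl⟩, by ring⟩

/-- Membership in the cone of polynomials, in terms of remainders. -/
theorem mem_cone_of_mem_coneOf [IsStrictOrderedRing K] {m : MonomialOrder σ}
    {p : Fin k → MvPolynomial σ K} {q q' : Fin r → MvPolynomial σ K}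
    {B : Finset (MvPolynomial σ K)} (hB : IsGroebnerBasis m B (Ideal.span (Set.range p)))
    (hq : ∀ i, IsRed m B (q i) (q' i)) {f f' : MvPolynomial σ K} (hf : f ∈ coneOf p q)
    (hsub : f - f' ∈ Ideal.span (Set.range p)) (hn : IsNormal m B f') :
    f' ∈ polyhedralCone K (Fin.snoc q' 1 : Fin (r + 1) → MvPolynomial σ K) := by
  -- If the ideal is everything, the generator `1` of the cone is not a normal form, but `f'` is
  -- `0`. Otherwise `1` is normal, and so is every combination of the generators.
  by_cases h1 : (1 : MvPolynomial σ K) ∈ Ideal.span (Set.range p)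
  · have hf' : f' = 0 := hB.eq_zero (by rw [(Ideal.eq_top_iff_one _).2 h1]; trivial) hn
    exact ⟨0, fun _ => le_rfl, by simp [hf']⟩
  · obtain ⟨a, ha, _, ⟨c, hc, rfl⟩, rfl⟩ := hf
    refine ⟨c, hc, sub_eq_zero.1 (hB.eq_zero ?_ (hn.sub (IsNormal.sum _ fun i _ =>
      IsNormal.smul ?_ _)))⟩
    · have := sum_snoc_sub_mem (fun i => (hq i).sub_mem hB) 1 c
      convert Ideal.add_mem _ (Submodule.sub_mem _ ha hsub) this using 1
      ring
    · induction i using Fin.lastCases with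
      | last => simpa using hB.isNormal_one h1
      | cast i => simpa using (hq i).isNormal hB

end Cones

/-! ### Reduction by a cone of polynomials -/

section Cred

variable {K D : Type*} [Field K]

theorem boundsOn_withTarget_nonempty [LinearOrder K] {T : D} {P : Set (Constraint K D)}
    {t : Aff K D} (ht : Aff.coeff T t = 0) : (boundsOn T (withTarget T P t)).Nonempty :=
  ⟨_, Or.inr ⟨_, Or.inr rfl, by simp [Aff.coeff_sub, Aff.coeff_dim_self, ht], rfl⟩⟩

theorem isModel_withTarget [LinearOrder K] {T : D} {P : Set (Constraint K D)} {t : Aff K D}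
    {w : D → K} : IsModel w (withTarget T P t) ↔ IsModel w P ∧ w T = t.eval w := by
  have : (Constraint.eq (Aff.dim T - t)).Holds w ↔ w T = t.eval w := by
    rw [Constraint.Holds, Aff.eval_sub, Aff.eval_dim, sub_eq_zero]
  rw [← this]
  simp [IsModel, withTarget, or_imp, forall_and, and_comm]

/-- Every model of `P` can be turned into one of `P` and `T = t`. -/
theorem exists_isModel_withTarget [LinearOrder K] {T : D} {P : Set (Constraint K D)}
    {t : Aff K D} (ht : Aff.coeff T t = 0) (hT : IsFree T P) {w : D → K} (hw : IsModel w P) :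
    ∃ w', (∀ y, y ≠ T → w' y = w y) ∧ w' T = t.eval w ∧ IsModel w' (withTarget T P t) := by
  obtain ⟨w', hoff, hx⟩ := exists_eq_off T w (t.eval w)
  refine ⟨w', hoff, hx, isModel_withTarget.2 ⟨fun c hc => ?_, ?_⟩⟩
  · have h1 := hw c hc
    have h2 := hT c hc
    cases c
    all_goals rwa [Constraint.Holds, Aff.eval_eq_of_eq_off_of_coeff hoff (by exact h2)]
  · rw [hx, Aff.eval_eq_of_eq_off_of_coeff hoff ht]

variable {σ : Type*} {r : ℕ} [LinearOrder K]

theorem isModel_monomialPolyhedron {q : Fin r → MvPolynomial σ K} {w : Dim σ → K} :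
    IsModel w (monomialPolyhedron q) ↔ ∀ i, 0 ≤ (toAff (q i)).eval w := by
  simp [IsModel, monomialPolyhedron, Constraint.Holds]

omit [LinearOrder K] in
theorem isFree_none_monomialPolyhedron (q : Fin r → MvPolynomial σ K) :
    IsFree none (monomialPolyhedron q) := by
  rintro _ ⟨i, rfl⟩
  exact coeff_none_toAff _

omit [LinearOrder K] in
theorem finite_monomialPolyhedron (q : Fin r → MvPolynomial σ K) :
    (monomialPolyhedron q).Finite :=
  Set.finite_range _

omit [LinearOrder K] in
theorem IsDimList.isFree {m : MonomialOrder σ} {q : Fin r → MvPolynomial σ K}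
    {t : MvPolynomial σ K} {ds : List (σ →₀ ℕ)} (h : IsDimList m q t ds) {μ : σ →₀ ℕ}
    (hμ : μ ∉ ds) : IsFree (some μ) (withTarget none (monomialPolyhedron q) (toAff t)) := by
  rw [h.2] at hμ
  rintro _ (⟨i, rfl⟩ | rfl)
  · rcases eq_or_ne μ 0 with rfl | h0
    · exact coeff_some_zero_toAff _
    · rw [Constraint.term, coeff_some_toAff _ h0]
      exact MvPolynomial.notMem_support_iff.1 fun hmem => hμ ⟨h0, Or.inr ⟨i, hmem⟩⟩
  · rw [Constraint.term, Aff.coeff_sub, Aff.coeff_dim_of_ne (by simp), zero_sub, neg_eq_zero]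
    rcases eq_or_ne μ 0 with rfl | h0
    · exact coeff_some_zero_toAff _
    · rw [coeff_some_toAff _ h0]
      exact MvPolynomial.notMem_support_iff.1 fun hmem => hμ ⟨h0, Or.inl hmem⟩

omit [LinearOrder K] in
theorem exists_isDimList (m : MonomialOrder σ) (q : Fin r → MvPolynomial σ K)
    (t : MvPolynomial σ K) : ∃ ds, IsDimList m q t ds := by
  classical
  let S : Finset (σ →₀ ℕ) := (t.support ∪ Finset.univ.biUnion fun i => (q i).support).erase 0
  refine ⟨((S.image m.toSyn).sort (· ≥ ·)).map m.toSyn.symm, ?_, fun μ => ?_⟩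
  · rw [List.pairwise_map]
    refine ((S.image m.toSyn).sortedGT_sort.pairwise).imp fun {a b} hab => ?_
    simpa using hab
  · simp [S, AddEquiv.symm_apply_eq]

variable [IsStrictOrderedRing K] {k : ℕ} {m : MonomialOrder σ} {p : Fin k → MvPolynomial σ K}
  {q : Fin r → MvPolynomial σ K} {t : MvPolynomial σ K}

theorem credTerminates [Finite σ] (m : MonomialOrder σ) (p : Fin k → MvPolynomial σ K)
    (q : Fin r → MvPolynomial σ K) (t : MvPolynomial σ K) : CredTerminates m p q t :=
  ⟨exists_isGroebnerBasis m _, fun B _ => ⟨fun _ => terminates_divStep m B _,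
    fun q' t' _ _ _ _ => terminates_reduceStep
      ((finite_monomialPolyhedron q').union (Set.finite_singleton _))
      (boundsOn_withTarget_nonempty (coeff_none_toAff t')) _ Set.finite_empty⟩⟩

/-- Emptiness would put `-1` into the cone, by Farkas' lemma; if the ideal is everything, all
remainders vanish and the origin is a model. -/
theorem exists_isModel_monomialPolyhedron {B : Finset (MvPolynomial σ K)}
    (hB : IsGroebnerBasis m B (Ideal.span (Set.range p))) {q' : Fin r → MvPolynomial σ K}
    (hq : ∀ i, IsRed m B (q i) (q' i))
    (h : 1 ∈ Ideal.span (Set.range p) ∨ -1 ∉ coneOf p q) :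
    ∃ w, IsModel w (monomialPolyhedron q') := by
  simp only [isModel_monomialPolyhedron]
  by_contra hcon
  have hmem := ofAff_mem_cone (Aff.neg_one_mem_cone _ hcon)
  rw [ofAff_const, map_neg, MvPolynomial.C_1] at hmem
  rcases h with h | h
  · refine hcon ⟨0, fun i => ?_⟩
    have : q' i = 0 :=
      hB.eq_zero (by rw [(Ideal.eq_top_iff_one _).2 h]; trivial) ((hq i).isNormal hB)
    rw [this]
    simp [toAff, Aff.eval]
  · exact h (mem_coneOf_of_mem_cone (fun i => (hq i).sub_mem hB) hmem)

theorem exists_isCred [Finite σ] (t : MvPolynomial σ K)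
    (h : 1 ∈ Ideal.span (Set.range p) ∨ -1 ∉ coneOf p q) : ∃ tstar, IsCred m p q t tstar := by
  obtain ⟨B, hB⟩ := exists_isGroebnerBasis m (Ideal.span (Set.range p))
  choose q' hq using fun i => exists_isRed m B (q i)
  obtain ⟨t', ht⟩ := exists_isRed m B t
  obtain ⟨ds, hds⟩ := exists_isDimList m q' t'
  obtain ⟨w, hw⟩ := exists_isModel_monomialPolyhedron hB hq h
  obtain ⟨w', -, -, hw'⟩ := exists_isModel_withTarget (coeff_none_toAff t')
    (isFree_none_monomialPolyhedron q') hw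
  obtain ⟨u, hu⟩ := exists_polyReduce (ds := ds.map some) (finite_monomialPolyhedron q')
    (by simp) (boundsOn_withTarget_nonempty (coeff_none_toAff t')) hw'
  exact ⟨_, B, hB, q', hq, t', ht, ds, hds, u, hu, rfl⟩

/-- Farkas' lemma needs a non-empty polyhedron; the model from which `u` was conjectured provides a
point. -/
theorem IsCred.sub_mem {tstar : MvPolynomial σ K} (h : IsCred m p q t tstar) :
    tstar - t ∈ coneOf p q := by
  obtain ⟨B, hB, q', hq, t', ht, ds, hds, u, ⟨U, hU, -, huU, hu⟩, rfl⟩ := h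
  obtain ⟨v, C, hv, hC, huC⟩ := exists_conjecture_of_reflTransGen hU huU
  have hbd := boundsOn_withTarget_nonempty (P := monomialPolyhedron q') (coeff_none_toAff t')
  have huT : Aff.coeff none u = 0 := hC.isFree hbd huC (Or.inl rfl)
  have hmem := Aff.mem_cone_of_nonneg (fun i => toAff (q' i)) (u - toAff t') v
    (isModel_monomialPolyhedron.1 (isModel_withTarget.1 hv).1) fun w hw => by
      obtain ⟨w', hoff, hx, hw'⟩ := exists_isModel_withTarget (coeff_none_toAff t')
        (isFree_none_monomialPolyhedron q') (isModel_monomialPolyhedron.2 hw)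
      have := hu w' hw'
      rwa [hx, Aff.eval_eq_of_eq_off_of_coeff hoff huT, ← sub_nonneg, ← Aff.eval_sub] at this
  replace hmem := ofAff_mem_cone hmem
  have hsub : ofAff (u - toAff t') = ofAff u - t' := by
    have : ofAff (u - toAff t') = ofAff u - ofAff (toAff t') := map_sub ofAffₗ u (toAff t')
    rwa [ofAff_toAff] at this
  rw [hsub] at hmem
  refine mem_coneOf_of_sub_mem ?_ (mem_coneOf_of_mem_cone (fun i => (hq i).sub_mem hB) hmem)
  convert Submodule.neg_mem _ (ht.sub_mem hB) using 1
  ring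

/-- The remainder `b'` of `b` is an implied bound on `T` and its degree does not exceed that of `b`,
so it is enough to compare `u` with `b'`. -/
theorem IsCred.degree_le {tstar : MvPolynomial σ K} (h : IsCred m p q t tstar)
    {b : MvPolynomial σ K} (hb : b - t ∈ coneOf p q) : m.degree tstar ≼[m] m.degree b := by
  obtain ⟨B, hB, q', hq, t', ht, ds, hds, u, ⟨U, hU, -, huU, hu⟩, rfl⟩ := h
  obtain ⟨v, C, hv, hC, huC⟩ := exists_conjecture_of_reflTransGen hU huU
  have hbd := boundsOn_withTarget_nonempty (P := monomialPolyhedron q') (coeff_none_toAff t')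
  obtain ⟨b', hbb'⟩ := exists_isRed m B b
  refine le_trans ?_ (hbb'.degree_le hB)
  have hmem := toAff_mem_cone (mem_cone_of_mem_coneOf hB hq (f' := b' - t') hb
    (by
      convert Submodule.sub_mem _ (hbb'.sub_mem hB) (ht.sub_mem hB) using 1
      ring)
    ((hbb'.isNormal hB).sub (ht.isNormal hB)))
  have hsub : toAff (b' - t') = toAff b' - toAff t' := map_sub toAffₗ b' t'
  have hvalid : ∀ w, IsModel w (withTarget none (monomialPolyhedron q') (toAff t')) →
      w none ≤ (toAff b').eval w := fun w hw => by
    obtain ⟨hw, hT⟩ := isModel_withTarget.1 hw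
    have := Aff.eval_nonneg_of_mem_cone hmem (isModel_monomialPolyhedron.1 hw)
    rwa [hsub, Aff.eval_sub, sub_nonneg, ← hT] at this
  obtain ⟨l₁, l₂, hl, hfree, hnext⟩ := hC.optimal
    ((finite_monomialPolyhedron q').union (Set.finite_singleton _)) hbd (by simp) hv huC
    (coeff_none_toAff b') hvalid
  obtain ⟨k₁, k₂, rfl, rfl, rfl⟩ := List.map_eq_append_iff.1 hl
  rw [m.degree_le_iff]
  intro μ hμ
  rcases eq_or_ne μ 0 with rfl | hμ0
  · simp
  rw [MvPolynomial.mem_support_iff, coeff_ofAff, if_neg hμ0, add_zero] at hμ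
  have hμds : μ ∈ k₁ ++ k₂ := by
    by_contra hnot
    exact hμ (hC.isFree hbd huC (Or.inr (hds.isFree hnot)))
  have hμk₂ : μ ∈ k₂ := (List.mem_append.1 hμds).resolve_left fun hmem =>
    hμ (hfree _ (List.mem_map_of_mem hmem))
  -- Every monomial other than `1` in the result lies in `k₂`. If `k₂` is empty, there is none;
  -- otherwise such a monomial is at most the head `d`, while `b'` contains some monomial of `k₁ ++
  -- [d]`.
  cases k₂ with
  | nil => cases hμk₂
  | cons d k₂ =>
    obtain ⟨y, hy, hyb⟩ := hnext (some d) (k₂.map some) rfl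
    obtain ⟨ν, hν, rfl⟩ : ∃ ν ∈ k₁ ++ [d], some ν = y := by
      simpa [or_comm, or_and_right, exists_or, eq_comm] using hy
    have hν0 : ν ≠ 0 := by
      rintro rfl
      exact hyb (coeff_some_zero_toAff _)
    rw [coeff_some_toAff _ hν0] at hyb
    refine le_trans ?_ (m.le_degree (MvPolynomial.mem_support_iff.2 hyb))
    obtain ⟨-, hpw, hcross⟩ := List.pairwise_append.1 hds.1
    have hμd : μ ≼[m] d := (List.mem_cons.1 hμk₂).elim (fun h => h ▸ le_rfl) fun h =>
      ((List.pairwise_cons.1 hpw).1 μ h).le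
    rcases List.mem_append.1 hν with hν | hν
    · exact (hcross ν hν μ hμk₂).le
    · rw [List.mem_singleton.1 hν]
      exact hμd

end Cred

end PolyCone

theorem mainTheorem1 {K σ : Type*} [Field K] [LinearOrder K] [IsStrictOrderedRing K] [Finite σ]
    (m : MonomialOrder σ) {k r : ℕ} (p : Fin k → MvPolynomial σ K) (q : Fin r → MvPolynomial σ K)
    (t : MvPolynomial σ K) :
    PolyCone.CredTerminates m p q t ∧
    ((1 ∈ Ideal.span (Set.range p) ∨ -1 ∉ PolyCone.coneOf p q) →
      ∃ tstar, PolyCone.IsCred m p q t tstar) ∧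
    ∀ tstar, PolyCone.IsCred m p q t tstar →
      tstar - t ∈ PolyCone.coneOf p q ∧
      ∀ b, b - t ∈ PolyCone.coneOf p q → m.degree tstar ≼[m] m.degree b :=
  ⟨PolyCone.credTerminates m p q t, PolyCone.exists_isCred t,
    fun _ h => ⟨h.sub_mem, fun _ hb => h.degree_le hb⟩⟩
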